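/- Let $\mathcal{D}$ be a triangulated category, $\Gamma$ a finitely generated free abelian group with a homomorphism $\mathrm{cl}\colon K(\mathcal{D})\to\Gamma$, and $0\subsetneq\Gamma_0\subsetneq\Gamma_1\subsetneq\cdots\subsetneq\Gamma_N=\Gamma$ a filtration whose subquotients $\mathbb{H}_i=\Gamma_i/\Gamma_{i-1}$ (with $\mathbb{H}_0=\Gamma_0$) are free; fix a norm $\|\cdot\|_i$ on each $\mathbb{H}_i\otimes\mathbb{R}$. Put $\mathbb{H}_i^\vee=\mathrm{Hom}_{\mathbb{Z}}(\mathbb{H}_i,\mathbb{C})$ and give $\prod_{i=0}^N\mathbb{H}_i^\vee$ the Euclidean topology. For $Z=\{Z_i\}\in\prod_i\mathbb{H}_i^\vee$ and $v\in\Gamma_m\setminus\Gamma_{m-1}$ (with $\Gamma_{-1}=\emptyset$) put $Z(v)=Z_m([v])$ and $\|v\|=\|[v]\|_m$; write $Z(E)$ and $\|E\|$ for $Z(\mathrm{cl}(E))$ and $\|\mathrm{cl}(E)\|$. A slicing $\mathcal{P}$ on $\mathcal{D}$ is a family of strictly full subcategories $\mathcal{P}(\phi)$, $\phi\in\mathbb{R}$,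 containing $0$, such that $\mathcal{P}(\phi)[1]=\mathcal{P}(\phi+1)$, $\mathrm{Hom}(E_1,E_2)=0$ if $E_i\in\mathcal{P}(\phi_i)$ and $\phi_1>\phi_2$, and every $E\neq0$ has a finite filtration by distinguished triangles $E_{j-1}\to E_j\to F_j\to E_{j-1}[1]$ $(1\le j\le n)$, $E_0=0$, $E_n=E$, with $0\ne F_j\in\mathcal{P}(\phi_j)$ and $\phi_1>\cdots>\phi_n$; put $\phi^+_{\mathcal{P}}(E)=\phi_1$ and $\phi^-_{\mathcal{P}}(E)=\phi_n$. It is locally finite if for some $0<\eta<1/2$ all the quasi-abelian categories $\mathcal{P}((\phi-\eta,\phi+\eta))$ (extension closures of the $\mathcal{P}(\psi)$ with $|\psi-\phi|<\eta$) are noetherian with respect to strict epimorphisms and artinian with respect to strict monomorphisms. The set $\mathrm{Slice}(\mathcal{D})$ of locally finite slicings has the topology of the generalized metric $$d(\mathcal{P},\mathcal{Q})=\sup_{0\ne E\in\mathcal{D}}\{|\phi^-_{\mathcal{P}}(E)-\phi^-_{\mathcal{Q}}(E)|,\ |\phi^+_{\mathcal{P}}(E)-\phi^+_{\mathcal{Q}}(E)|\}\in[0,\infty].$$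 $\mathrm{Stab}_{\Gamma_\bullet}(\mathcal{D})\subset\mathrm{Slice}(\mathcal{D})\times\prod_i\mathbb{H}_i^\vee$, with the induced topology, is the set of pairs $(Z,\mathcal{P})$ such that $Z(E)\in\mathbb{R}_{>0}\exp(i\pi\phi)$ for all $0\neq E\in\mathcal{P}(\phi)$, and such that for some $C>0$ one has $\|E\|\le C|Z(E)|$ for all nonzero $E\in\bigcup_\phi\mathcal{P}(\phi)$. For the heart $\mathcal{A}$ of a bounded t-structure, a weak stability function on $\mathcal{A}$ is a $Z\in\prod_i\mathbb{H}_i^\vee$ with $Z(E)\in\{r\exp(i\pi\phi):r>0,\ 0<\phi\le1\}$ for all $0\ne E\in\mathcal{A}$. An object $0\ne E\in\mathcal{A}$ is $Z$-semistable if $\arg Z(F)\le\arg Z(G)$ for every exact sequence $0\to F\to E\to G\to0$ in $\mathcal{A}$ with $F,G\ne0$. $Z$ has the Harder–Narasimhan property if every $0\neq E\in\mathcal{A}$ has a finite filtration in $\mathcal{A}$ with $Z$-semistable subquotients of strictly decreasing arguments. We say that $(Z,\mathcal{A})$ determines the point $(Z,\mathcal{P})\in\mathrm{Stab}_{\Gamma_\bullet}(\mathcal{D})$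 if $Z$ is a weak stability function on $\mathcal{A}$ with the Harder–Narasimhan property and, for $0<\phi\le1$, $\mathcal{P}(\phi)$ consists of $0$ and the $Z$-semistable $E\in\mathcal{A}$ with $Z(E)\in\mathbb{R}_{>0}\exp(i\pi\phi)$. **Lemma.** Let $\mathcal{A}$ be the heart of a bounded t-structure on $\mathcal{D}$. (1) Let $(\mathcal{T},\mathcal{F})$ be a torsion pair on $\mathcal{A}$ and let $\mathcal{B}=\langle\mathcal{F}[1],\mathcal{T}\rangle_{\mathrm{ex}}$ be the associated tilting (extension closure in $\mathcal{D}$). Let $[0,1)\ni t\mapsto Z_t\in\prod_{i=0}^N\mathbb{H}_i^\vee$ be a continuous map such that $(Z_t,\mathcal{A})$ for $0<t<1$ and $(Z_0,\mathcal{B})$ determine points $\sigma_t$ and $\sigma_0$ of $\mathrm{Stab}_{\Gamma_\bullet}(\mathcal{D})$. Then $\lim_{t\to0}\sigma_t=\sigma_0$ in $\mathrm{Stab}_{\Gamma_\bullet}(\mathcal{D})$. (2) Let $(0,1)\ni t\mapsto Z_t\in\prod_{i=0}^N\mathbb{H}_i^\vee$ be a continuous map such that $(Z_t,\mathcal{A})$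 determines a point $\sigma_t$ of $\mathrm{Stab}_{\Gamma_\bullet}(\mathcal{D})$ for all $0<t<1$. Then $t\mapsto\sigma_t$ is continuous on $(0,1)$. -/

import Mathlib

open CategoryTheory CategoryTheory.Limits CategoryTheory.Pretriangulated
  CategoryTheory.Triangulated
open scoped TensorProduct Topology

universe v u w

noncomputable section

namespace WeakStab

/-! ### Filtered lattices and central charges -/

/-- A filtration `0 ⊊ Γ_0 ⊊ Γ_1 ⊊ ⋯ ⊊ Γ_N = Γ` of an abelian group with free subquotients
`ℍ_i = Γ_i / Γ_{i-1}`, together with a norm on each `ℍ_i ⊗ ℝ`.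
The index is shifted by one: `sub 0 = 0`, and `Γ_i` is `sub i.succ` for `i : Fin (N + 1)`. -/
structure FilteredLattice (Γ : Type w) [AddCommGroup Γ] where
  N : ℕ
  sub : Fin (N + 2) → AddSubgroup Γ
  strictMono : StrictMono sub
  sub_zero : sub 0 = ⊥
  sub_last : sub (Fin.last (N + 1)) = ⊤
  free : ∀ i : Fin (N + 1),
    Module.Free ℤ (↥(sub i.succ) ⧸ (sub i.castSucc).addSubgroupOf (sub i.succ))
  /-- a norm on `ℍ_i ⊗ ℝ`: a seminorm which is positive on nonzero vectors -/
  nrm : ∀ i : Fin (N + 1),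
    Seminorm ℝ (ℝ ⊗[ℤ] (↥(sub i.succ) ⧸ (sub i.castSucc).addSubgroupOf (sub i.succ)))
  nrm_eq_zero : ∀ i x, nrm i x = 0 → x = 0

section Lattice

variable {Γ : Type w} [AddCommGroup Γ] (L : FilteredLattice Γ)

/-- The subquotient `ℍ_i = Γ_i / Γ_{i-1}`, `0 ≤ i ≤ N`. -/
abbrev FilteredLattice.Gr (i : Fin (L.N + 1)) : Type w :=
  ↥(L.sub i.succ) ⧸ (L.sub i.castSucc).addSubgroupOf (L.sub i.succ)

/-- Each `v ∈ Γ` lies in `Γ_m` and in no earlier `Γ_k` for some index `m` (clearly unique). -/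
theorem FilteredLattice.exists_level (v : Γ) :
    ∃ m : Fin (L.N + 1), v ∈ L.sub m.succ ∧ ∀ k < m, v ∉ L.sub k.succ := by
  have hne : ∃ m : Fin (L.N + 1), v ∈ L.sub m.succ :=
    ⟨Fin.last L.N, by rw [Fin.succ_last, L.sub_last]; trivial⟩
  obtain ⟨m, hm, hmin⟩ := WellFounded.has_min (wellFounded_lt (α := Fin (L.N + 1)))
    {m | v ∈ L.sub m.succ} hne
  exact ⟨m, hm, fun k hk hv => hmin k hv hk⟩

/-- The index `m` with `v ∈ Γ_m ∖ Γ_{m-1}`, where `Γ_{-1} = ∅` (so `0` has index `0`). -/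
def FilteredLattice.level (v : Γ) : Fin (L.N + 1) := (L.exists_level v).choose

theorem FilteredLattice.mem_level (v : Γ) : v ∈ L.sub (L.level v).succ :=
  (L.exists_level v).choose_spec.1

/-- The class `[v] ∈ ℍ_m` of `v ∈ Γ_m ∖ Γ_{m-1}`. -/
def FilteredLattice.cls (v : Γ) : L.Gr (L.level v) :=
  QuotientAddGroup.mk ⟨v, L.mem_level v⟩

/-- The map `Γ → ℝ` sending `v ∈ Γ_m ∖ Γ_{m-1}` to the norm of `[v] ∈ ℍ_m ⊗ ℝ`. -/
def FilteredLattice.size (v : Γ) : ℝ := L.nrm (L.level v) ((1 : ℝ) ⊗ₜ[ℤ] L.cls v)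

/-- The space `∏_i ℍ_i^∨`, where `ℍ_i^∨ = Hom_ℤ(ℍ_i, ℂ)`. -/
def CentralCharge : Type w := ∀ i : Fin (L.N + 1), L.Gr i →+ ℂ

/-- The Euclidean topology on `∏_i Hom_ℤ(ℍ_i, ℂ)`: since every `ℍ_i` is free of finite rank when
`Γ` is finitely generated, this is the topology of convergence of all values. -/
instance : TopologicalSpace (CentralCharge L) :=
  TopologicalSpace.induced
    (fun (Z : CentralCharge L) (i : Fin (L.N + 1)) (x : L.Gr i) => Z i x) inferInstance

variable {L}

/-- The (in general not additive) map `Z : Γ → ℂ`, `Z(v) = Z_m([v])` for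
`v ∈ Γ_m ∖ Γ_{m-1}`. -/
def CentralCharge.eval (Z : CentralCharge L) (v : Γ) : ℂ := Z (L.level v) (L.cls v)

end Lattice

/-- The open ray `ℝ_{>0} exp(iπφ)`. -/
def ray (φ : ℝ) : Set ℂ :=
  {z | ∃ r : ℝ, 0 < r ∧ z = (r : ℂ) * Complex.exp (Complex.I * (Real.pi : ℂ) * (φ : ℂ))}

/-- The half plane `{r exp(iπφ) : r > 0, 0 < φ ≤ 1}`. -/
def halfPlane : Set ℂ := ⋃ φ ∈ Set.Ioc (0 : ℝ) 1, ray φ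

/-! ### Grothendieck group, extension closures, filtrations by triangles -/

variable (D : Type u) [Category.{v} D] [HasZeroObject D] [HasShift D ℤ] [Preadditive D]
  [∀ n : ℤ, (shiftFunctor D n).Additive] [Pretriangulated D]

/-- The Grothendieck group of a triangulated category: generated by the objects, with the relation
`[B] = [A] + [C]` for each distinguished triangle `A ⟶ B ⟶ C ⟶ A[1]`. -/
def K0 : Type u :=
  FreeAbelianGroup D ⧸ AddSubgroup.closure
    {x : FreeAbelianGroup D | ∃ T : Triangle D, T ∈ distTriang D ∧
      x = FreeAbelianGroup.of T.obj₂ - FreeAbelianGroup.of T.obj₁ - FreeAbelianGroup.of T.obj₃}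

instance : AddCommGroup (K0 D) := by
  unfold K0
  infer_instance

variable {D}

/-- The class of an object in the Grothendieck group. -/
def K0.of (E : D) : K0 D := QuotientAddGroup.mk (FreeAbelianGroup.of E)

/-- The smallest full subcategory which contains the objects satisfying `S` (and zero) and is closed
under extensions; closure under isomorphisms follows. -/
inductive extClosure (S : ObjectProperty D) : ObjectProperty D
  | zero (E : D) (h : IsZero E) : extClosure S E
  | of (E : D) (h : S E) : extClosure S E
  | ext (T : Triangle D) (hT : T ∈ distTriang D) (h₁ : extClosure S T.obj₁)
      (h₃ : extClosure S T.obj₃) : extClosure S T.obj₂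

/-- A diagram `0 = E_0 ⟶ E_1 ⟶ ⋯ ⟶ E_{n+1} = E` completed to distinguished triangles
`E_j ⟶ E_{j+1} ⟶ F_{j+1} ⟶ E_j[1]`; here `F_{j+1}` is `factor j`. -/
structure Tower (E : D) (n : ℕ) where
  obj : Fin (n + 2) → D
  factor : Fin (n + 1) → D
  isZero : IsZero (obj 0)
  topIso : obj (Fin.last (n + 1)) ≅ E
  incl (j : Fin (n + 1)) : obj j.castSucc ⟶ obj j.succ
  proj (j : Fin (n + 1)) : obj j.succ ⟶ factor j
  conn (j : Fin (n + 1)) : factor j ⟶ (obj j.castSucc)⟦(1 : ℤ)⟧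
  distinguished (j : Fin (n + 1)) : Triangle.mk (incl j) (proj j) (conn j) ∈ distTriang D

/-! ### Slicings -/

/-- A Harder-Narasimhan filtration of `E` with respect to subcategories `P φ`, with nonzero
factors. -/
structure HNFiltration (P : ℝ → ObjectProperty D) (E : D) where
  n : ℕ
  tower : Tower E n
  phase : Fin (n + 1) → ℝ
  strictAnti : StrictAnti phase
  mem (j : Fin (n + 1)) : P (phase j) (tower.factor j)
  ne_zero (j : Fin (n + 1)) : ¬ IsZero (tower.factor j)

variable (D) in
/-- A slicing. The subcategories are strictly full and contain the zero objects (that they are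
closed under finite direct sums follows from the other conditions). -/
structure Slicing where
  P : ℝ → ObjectProperty D
  closedUnderIso (φ : ℝ) : (P φ).IsClosedUnderIsomorphisms
  zero_mem (φ : ℝ) (E : D) : IsZero E → P φ E
  shift_iff (φ : ℝ) (E : D) : P (φ + 1) (E⟦(1 : ℤ)⟧) ↔ P φ E
  hom_eq_zero (φ₁ φ₂ : ℝ) (E₁ E₂ : D) (h₁ : P φ₁ E₁) (h₂ : P φ₂ E₂) (h : φ₂ < φ₁)
    (f : E₁ ⟶ E₂) : f = 0
  exists_hn (E : D) : ¬ IsZero E → Nonempty (HNFiltration P E)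

/-- The subcategory `P(I)`: the extension closure of the `P(φ)` with `φ ∈ I`. -/
def Slicing.interval (P : Slicing D) (I : Set ℝ) : ObjectProperty D :=
  extClosure (fun E => ∃ φ ∈ I, P.P φ E)

/-- `φ⁺(E)`, the largest phase of a Harder-Narasimhan filtration of `E ≠ 0`
(it does not depend on the filtration). -/
def Slicing.phasePlus (P : Slicing D) (E : D) (hE : ¬ IsZero E) : ℝ :=
  (P.exists_hn E hE).some.phase 0

/-- `φ⁻(E)`, the smallest phase of a Harder-Narasimhan filtration of `E ≠ 0`
(it does not depend on the filtration). -/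
def Slicing.phaseMinus (P : Slicing D) (E : D) (hE : ¬ IsZero E) : ℝ :=
  (P.exists_hn E hE).some.phase (Fin.last _)

/-- `i : A ⟶ B` is a strict monomorphism of the subcategory `Q`: it is completed to a distinguished
triangle `A ⟶ B ⟶ C ⟶ A[1]` with `A, B, C` in `Q`. -/
def IsStrictMono (Q : ObjectProperty D) {A B : D} (i : A ⟶ B) : Prop :=
  Q A ∧ Q B ∧ ∃ (C : D) (j : B ⟶ C) (k : C ⟶ A⟦(1 : ℤ)⟧),
    Q C ∧ Triangle.mk i j k ∈ distTriang D

/-- `j : B ⟶ C` is a strict epimorphism of the subcategory `Q`: it is completed to a distinguished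
triangle `A ⟶ B ⟶ C ⟶ A[1]` with `A, B, C` in `Q`. -/
def IsStrictEpi (Q : ObjectProperty D) {B C : D} (j : B ⟶ C) : Prop :=
  Q B ∧ Q C ∧ ∃ (A : D) (i : A ⟶ B) (k : C ⟶ A⟦(1 : ℤ)⟧),
    Q A ∧ Triangle.mk i j k ∈ distTriang D

/-- `Q` is noetherian with respect to strict epimorphisms and artinian with respect to strict
monomorphisms: infinite chains of strict quotients, and of strict subobjects, stabilize. -/
def IsFiniteLength (Q : ObjectProperty D) : Prop :=
  (∀ (E : ℕ → D) (f : ∀ n, E n ⟶ E (n + 1)), (∀ n, IsStrictEpi Q (f n)) →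
    ∃ n₀, ∀ n ≥ n₀, IsIso (f n)) ∧
  (∀ (E : ℕ → D) (f : ∀ n, E (n + 1) ⟶ E n), (∀ n, IsStrictMono Q (f n)) →
    ∃ n₀, ∀ n ≥ n₀, IsIso (f n))

/-- Local finiteness. (With `η < 1/2` the categories `P((φ - η, φ + η))` are quasi-abelian; the
condition for `η` implies the condition for all smaller positive numbers.) -/
def Slicing.IsLocallyFinite (P : Slicing D) : Prop :=
  ∃ η : ℝ, 0 < η ∧ η < 1 / 2 ∧
    ∀ φ : ℝ, IsFiniteLength (P.interval (Set.Ioo (φ - η) (φ + η)))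

variable (D) in
/-- The set `Slice(D)` of locally finite slicings. -/
def Slice := {P : Slicing D // P.IsLocallyFinite}

/-- The generalized metric on `Slice(D)`: `d(P, Q)` is the supremum over `E ≠ 0` of
`|φ⁻_P(E) - φ⁻_Q(E)|` and `|φ⁺_P(E) - φ⁺_Q(E)|`, with values in `[0, ∞]`. The topology of `Slice(D)`
is the one of this generalized metric. -/
instance : PseudoEMetricSpace (Slice D) where
  edist P Q := ⨆ E : {E : D // ¬ IsZero E},
    max (edist (P.1.phaseMinus E.1 E.2) (Q.1.phaseMinus E.1 E.2))
      (edist (P.1.phasePlus E.1 E.2) (Q.1.phasePlus E.1 E.2))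
  edist_self P := by simp
  edist_comm P Q := by simp only [edist_comm]
  edist_triangle P Q R := by
    refine iSup_le fun E => max_le ?_ ?_
    · exact (edist_triangle _ (Q.1.phaseMinus E.1 E.2) _).trans
        (add_le_add ((le_max_left _ _).trans (le_iSup (fun E : {E : D // ¬ IsZero E} =>
          max (edist (P.1.phaseMinus E.1 E.2) (Q.1.phaseMinus E.1 E.2))
            (edist (P.1.phasePlus E.1 E.2) (Q.1.phasePlus E.1 E.2))) E))
          ((le_max_left _ _).trans (le_iSup (fun E : {E : D // ¬ IsZero E} =>
          max (edist (Q.1.phaseMinus E.1 E.2) (R.1.phaseMinus E.1 E.2))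
            (edist (Q.1.phasePlus E.1 E.2) (R.1.phasePlus E.1 E.2))) E)))
    · exact (edist_triangle _ (Q.1.phasePlus E.1 E.2) _).trans
        (add_le_add ((le_max_right _ _).trans (le_iSup (fun E : {E : D // ¬ IsZero E} =>
          max (edist (P.1.phaseMinus E.1 E.2) (Q.1.phaseMinus E.1 E.2))
            (edist (P.1.phasePlus E.1 E.2) (Q.1.phasePlus E.1 E.2))) E))
          ((le_max_right _ _).trans (le_iSup (fun E : {E : D // ¬ IsZero E} =>
          max (edist (Q.1.phaseMinus E.1 E.2) (R.1.phaseMinus E.1 E.2))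
            (edist (Q.1.phasePlus E.1 E.2) (R.1.phasePlus E.1 E.2))) E)))

/-! ### Weak stability conditions -/

section Stability

variable {Γ : Type w} [AddCommGroup Γ] {L : FilteredLattice Γ} (cl : K0 D →+ Γ)

/-- The value `Z(E) = Z(cl(E))` on an object. -/
def CentralCharge.onObj (Z : CentralCharge L) (E : D) : ℂ := Z.eval (cl (K0.of E))

variable (L) in
/-- The set `Stab_{Γ_•}(D)` of weak stability conditions. -/
structure Stab where
  Z : CentralCharge L
  P : Slice D
  phase (φ : ℝ) (E : D) : P.1.P φ E → ¬ IsZero E → Z.onObj cl E ∈ ray φ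
  support : ∃ C : ℝ, 0 < C ∧ ∀ (φ : ℝ) (E : D), P.1.P φ E → ¬ IsZero E →
    L.size (cl (K0.of E)) ≤ C * ‖Z.onObj cl E‖

/-- The topology on `Stab_{Γ_•}(D)` induced from `Slice(D) × ∏_i ℍ_i^∨`. -/
instance : TopologicalSpace (Stab L cl) :=
  TopologicalSpace.induced (fun σ : Stab L cl => (σ.P, σ.Z)) inferInstance

/-! In what follows `A` is the heart of a bounded t-structure. A short exact sequence
`0 ⟶ F ⟶ E ⟶ G ⟶ 0` in `A` is a distinguished triangle `F ⟶ E ⟶ G ⟶ F[1]` with `F`, `E`, `G`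
in `A`. -/

/-- `Z` is a weak stability function on `A`. -/
def IsWeakStabilityFunction (Z : CentralCharge L) (A : ObjectProperty D) : Prop :=
  ∀ E : D, A E → ¬ IsZero E → Z.onObj cl E ∈ halfPlane

/-- `0 ≠ E ∈ A` is `Z`-semistable: `arg Z(F) ≤ arg Z(G)` for each short exact sequence
`0 ⟶ F ⟶ E ⟶ G ⟶ 0` in `A` with `F` and `G` nonzero. -/
def IsSemistable (Z : CentralCharge L) (A : ObjectProperty D) (E : D) : Prop :=
  A E ∧ ¬ IsZero E ∧
    ∀ (F G : D) (f : F ⟶ E) (g : E ⟶ G) (h : G ⟶ F⟦(1 : ℤ)⟧),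
      Triangle.mk f g h ∈ distTriang D → A F → A G → ¬ IsZero F → ¬ IsZero G →
        (Z.onObj cl F).arg ≤ (Z.onObj cl G).arg

/-- The Harder-Narasimhan property: each nonzero `E ∈ A` has a filtration
`0 = E_0 ⊂ E_1 ⊂ ⋯ ⊂ E_k = E` in `A` with `Z`-semistable subquotients of decreasing arguments. -/
def HasHNProperty (Z : CentralCharge L) (A : ObjectProperty D) : Prop :=
  ∀ E : D, A E → ¬ IsZero E → ∃ (n : ℕ) (T : Tower E n),
    (∀ j, A (T.obj j)) ∧ (∀ j, IsSemistable cl Z A (T.factor j)) ∧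
      StrictAnti fun j => (Z.onObj cl (T.factor j)).arg

variable {cl}

/-- The pair `(Z, A)` determines the point `σ` of `Stab_{Γ_•}(D)`: `Z` is a weak stability function
on `A` with the Harder-Narasimhan property, and for `0 < φ ≤ 1` the subcategory `P(φ)` consists of
the `Z`-semistable `E ∈ A` with `Z(E) ∈ ℝ_{>0} exp(iπφ)` (and the zero objects); the other `P(φ)`
are then determined by `P(φ)[1] = P(φ + 1)`. -/
structure Stab.IsDeterminedBy (σ : Stab L cl) (Z : CentralCharge L) (A : ObjectProperty D) :
    Prop where
  Z_eq : σ.Z = Z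
  weakStabilityFunction : IsWeakStabilityFunction cl Z A
  hn : HasHNProperty cl Z A
  mem_iff (φ : ℝ) (hφ : φ ∈ Set.Ioc (0 : ℝ) 1) (E : D) :
    σ.P.1.P φ E ↔ (IsZero E ∨ (IsSemistable cl Z A E ∧ Z.onObj cl E ∈ ray φ))

end Stability

/-! ### Torsion pairs and tilting -/

/-- `(T, F)` is a torsion pair on the heart `A` of a t-structure. -/
structure IsTorsionPair (A T F : ObjectProperty D) : Prop where
  le_left : T ≤ A
  le_right : F ≤ A
  hom_eq_zero (X Y : D) (hX : T X) (hY : F Y) (f : X ⟶ Y) : f = 0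
  exists_triangle (E : D) (hE : A E) : ∃ (X Y : D) (f : X ⟶ E) (g : E ⟶ Y) (h : Y ⟶ X⟦(1 : ℤ)⟧),
    T X ∧ F Y ∧ Triangle.mk f g h ∈ distTriang D

/-- The tilting `⟨F[1], T⟩_ex`. -/
def tilt (T F : ObjectProperty D) : ObjectProperty D :=
  extClosure (fun E => (∃ X : D, F X ∧ Nonempty (E ≅ X⟦(1 : ℤ)⟧)) ∨ T E)

end WeakStab

end

/-! Convergence of the central charges is given, so the point is convergence of the slicings. The
support property of the limit `σ₀` makes convergence of `Z_t` uniform on semistable objects: for `t`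
near the limit, `Z_t(E)` has a phase within `δ` of `φ` for all nonzero `E ∈ P₀(φ)` at once
(`CentralCharge.eventually_norm_sub_le`, `exists_perturbation_bound`). Only the support constant of
`σ₀` enters, nothing uniform in `t`.

A central charge sees phases only modulo 2, so a coarse bound is needed as well: the heart `A` lies
in `P₀([0, 1])`. In (2) this is clear, since `A` also determines `σ₀`. In (1) it is clear for the
torsion part, which lies in the tilt. For `X` in the torsion-free part, the last Harder-Narasimhan
factor `G` of `X[1]` has `G[-1] ∈ A`, so `Im Z_t(G) ≤ 0`; in the limit this forces `G` to have phase
1, and so `X` has phase 0 (`Stab.IsDeterminedBy.phase_bounds_of_tilt`).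

Both inputs meet in `Slicing.phase_bounds_of_central_charge`. If the first `P_t`-factor of `E ∈
P₀(φ)` had phase above `φ + 2δ`, the coarse bound would confine its `P₀`-phases to an interval `[n,
φ]` of length less than `1 - 2δ`. On so short an interval the `Z_t`-values stay in a convex sector,
so the factor would have phase at most `φ + δ`. The last factor is dual. Although `Z` is not
additive, convex sectors are still preserved (`CentralCharge.eval_add_mem`). -/

namespace WeakStab

/-! ### Rays and sectors -/

/-- The closed sector `{r exp(iπφ) : r > 0, a ≤ φ ≤ b}`, without its vertex. -/
def sector (a b : ℝ) : Set ℂ := {z | ∃ φ ∈ Set.Icc a b, z ∈ ray φ}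

theorem ne_zero_of_mem_ray {φ : ℝ} {z : ℂ} (h : z ∈ ray φ) : z ≠ 0 := by
  obtain ⟨r, hr, rfl⟩ := h
  exact mul_ne_zero (by exact_mod_cast hr.ne') (Complex.exp_ne_zero _)

theorem ne_zero_of_mem_sector {a b : ℝ} {z : ℂ} (h : z ∈ sector a b) : z ≠ 0 := by
  obtain ⟨φ, -, h⟩ := h
  exact ne_zero_of_mem_ray h

theorem exp_phase (φ : ℝ) : Complex.exp (Complex.I * (Real.pi : ℂ) * (φ : ℂ)) =
    Complex.exp (((Real.pi * φ : ℝ) : ℂ) * Complex.I) := by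
  congr 1; push_cast; ring

theorem im_mul_exp (r φ a : ℝ) :
    (((r : ℂ) * Complex.exp (Complex.I * (Real.pi : ℂ) * (φ : ℂ))) *
      Complex.exp (Complex.I * (Real.pi : ℂ) * ((-a : ℝ) : ℂ))).im =
      r * Real.sin (Real.pi * (φ - a)) := by
  rw [mul_assoc, ← Complex.exp_add, ← mul_add, ← Complex.ofReal_add, exp_phase,
    Complex.im_ofReal_mul, Complex.exp_ofReal_mul_I_im, sub_eq_add_neg]

theorem re_mul_exp (r φ a : ℝ) :
    (((r : ℂ) * Complex.exp (Complex.I * (Real.pi : ℂ) * (φ : ℂ))) *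
      Complex.exp (Complex.I * (Real.pi : ℂ) * ((-a : ℝ) : ℂ))).re =
      r * Real.cos (Real.pi * (φ - a)) := by
  rw [mul_assoc, ← Complex.exp_add, ← mul_add, ← Complex.ofReal_add, exp_phase,
    Complex.re_ofReal_mul, Complex.exp_ofReal_mul_I_re, sub_eq_add_neg]

theorem im_of_mem_ray {φ : ℝ} {z : ℂ} (h : z ∈ ray φ) :
    ∃ r : ℝ, 0 < r ∧ z.im = r * Real.sin (Real.pi * φ) := by
  obtain ⟨r, hr, rfl⟩ := h
  refine ⟨r, hr, ?_⟩
  rw [exp_phase, Complex.im_ofReal_mul, Complex.exp_ofReal_mul_I_im]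

theorem mem_ray_arg {z : ℂ} (hz : z ≠ 0) : z ∈ ray (z.arg / Real.pi) := by
  refine ⟨‖z‖, norm_pos_iff.2 hz, ?_⟩
  rw [exp_phase, mul_div_cancel₀ _ Real.pi_ne_zero, Complex.norm_mul_exp_arg_mul_I]

theorem mul_exp_mem_ray {φ a : ℝ} {z : ℂ} (h : z ∈ ray φ) :
    z * Complex.exp (Complex.I * (Real.pi : ℂ) * (a : ℂ)) ∈ ray (φ + a) := by
  obtain ⟨r, hr, rfl⟩ := h
  refine ⟨r, hr, ?_⟩
  rw [mul_assoc, ← Complex.exp_add, ← mul_add, ← Complex.ofReal_add]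

theorem ray_phase_unique {φ ψ : ℝ} {z : ℂ} (h₁ : z ∈ ray φ) (h₂ : z ∈ ray ψ)
    (h : |φ - ψ| < 2) : φ = ψ := by
  obtain ⟨r, hr, h₁⟩ := h₁
  obtain ⟨s, hs, rfl⟩ := h₂
  have hn := congrArg norm h₁
  simp only [exp_phase, norm_mul, Complex.norm_exp_ofReal_mul_I, Complex.norm_real,
    Real.norm_eq_abs, abs_of_pos hr, abs_of_pos hs, mul_one] at hn
  subst hn
  have h₃ := mul_left_cancel₀ (by exact_mod_cast hs.ne') h₁
  obtain ⟨n, hn⟩ := Complex.exp_eq_exp_iff_exists_int.1 h₃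
  have h₄ : ψ = φ + 2 * n := by
    have h5 : (Complex.I * (Real.pi : ℂ)) * (ψ : ℂ) =
        (Complex.I * (Real.pi : ℂ)) * ((φ + 2 * n : ℝ) : ℂ) := by
      rw [hn]; push_cast; ring
    exact_mod_cast mul_left_cancel₀
      (mul_ne_zero Complex.I_ne_zero (by exact_mod_cast Real.pi_ne_zero)) h5
  have h6 : |(n : ℝ)| < 1 := by
    rw [h₄, show φ - (φ + 2 * n) = -(2 * n) by ring, abs_neg, abs_mul, abs_two] at h
    linarith
  have h7 : n = 0 := Int.abs_lt_one_iff.1 (by exact_mod_cast h6)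
  simp [h₄, h7]

/-- The sector spans an angle less than `π`. After rotation by its bisector `m` the sum has positive
real part, hence a phase within `1/2` of `m`; rotating by each edge then bounds this phase through
the sign of the imaginary part. -/
theorem sector_add {a b : ℝ} (hab : b - a < 1) {z w : ℂ} (hz : z ∈ sector a b)
    (hw : w ∈ sector a b) : z + w ∈ sector a b := by
  obtain ⟨φ, ⟨hφa, hφb⟩, r, hr, rfl⟩ := hz
  obtain ⟨ψ, ⟨hψa, hψb⟩, s, hs, rfl⟩ := hw
  have hπ := Real.pi_pos
  set e : ℝ → ℂ := fun x => Complex.exp (Complex.I * (Real.pi : ℂ) * ((-x : ℝ) : ℂ)) with he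
  set x := (r : ℂ) * Complex.exp (Complex.I * (Real.pi : ℂ) * (φ : ℂ)) +
    (s : ℂ) * Complex.exp (Complex.I * (Real.pi : ℂ) * (ψ : ℂ)) with hx
  set m := (a + b) / 2 with hm
  have hre : 0 < (x * e m).re := by
    rw [hx, add_mul, Complex.add_re, re_mul_exp, re_mul_exp]
    refine add_pos (mul_pos hr (Real.cos_pos_of_mem_Ioo ⟨?_, ?_⟩))
      (mul_pos hs (Real.cos_pos_of_mem_Ioo ⟨?_, ?_⟩)) <;> nlinarith
  have hne : x * e m ≠ 0 := fun h => by simp [h] at hre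
  have harg := abs_lt.1 (Complex.abs_arg_lt_pi_div_two_iff.2 (Or.inl hre))
  set θ := (x * e m).arg / Real.pi with hθ
  have hθ₁ : -(1 / 2) < θ := by rw [hθ, lt_div_iff₀ hπ]; linarith
  have hθ₂ : θ < 1 / 2 := by rw [hθ, div_lt_iff₀ hπ]; linarith
  have hray : x ∈ ray (θ + m) := by
    have h1 := mul_exp_mem_ray (a := m) (mem_ray_arg hne)
    rwa [mul_assoc, ← Complex.exp_add, ← mul_add, ← Complex.ofReal_add, neg_add_cancel,
      Complex.ofReal_zero, mul_zero, Complex.exp_zero, mul_one] at h1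
  refine ⟨θ + m, ⟨?_, ?_⟩, hray⟩
  · have him : 0 ≤ (x * e a).im := by
      rw [hx, add_mul, Complex.add_im, im_mul_exp, im_mul_exp]
      refine add_nonneg (mul_nonneg hr.le (Real.sin_nonneg_of_nonneg_of_le_pi ?_ ?_))
        (mul_nonneg hs.le (Real.sin_nonneg_of_nonneg_of_le_pi ?_ ?_)) <;> nlinarith
    by_contra! hlt
    obtain ⟨q, hq, hx'⟩ := hray
    rw [hx', im_mul_exp] at him
    have := Real.sin_neg_of_neg_of_neg_pi_lt (x := Real.pi * (θ + m - a)) (by nlinarith)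
      (by nlinarith)
    nlinarith
  · have him : (x * e b).im ≤ 0 := by
      rw [hx, add_mul, Complex.add_im, im_mul_exp, im_mul_exp]
      refine add_nonpos (mul_nonpos_of_nonneg_of_nonpos hr.le
        (Real.sin_nonpos_of_nonpos_of_neg_pi_le ?_ ?_)) (mul_nonpos_of_nonneg_of_nonpos hs.le
        (Real.sin_nonpos_of_nonpos_of_neg_pi_le ?_ ?_)) <;> nlinarith
    by_contra! hlt
    obtain ⟨q, hq, hx'⟩ := hray
    rw [hx', im_mul_exp] at him
    have := Real.sin_pos_of_pos_of_lt_pi (x := Real.pi * (θ + m - b)) (by nlinarith)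
      (by nlinarith)
    nlinarith

/-- A small relative perturbation moves the phase by a small amount. -/
theorem exists_perturbation_bound {δ : ℝ} (hδ : 0 < δ) : ∃ η : ℝ, 0 < η ∧
    ∀ (φ : ℝ) (z w : ℂ), z ∈ ray φ → ‖w - z‖ ≤ η * ‖z‖ → w ∈ sector (φ - δ) (φ + δ) := by
  have hc : ContinuousAt Complex.arg 1 := Complex.continuousAt_arg (by simp)
  obtain ⟨ε, hε, h⟩ := Metric.continuousAt_iff.1 hc (Real.pi * δ) (mul_pos Real.pi_pos hδ)
  -- `ε / 2` gives the strict inequality required by continuity of `arg` at 1; `1 / 2` keeps `w / z`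
  -- away from 0.
  refine ⟨min (ε / 2) (1 / 2), by positivity, fun φ z w hz hw => ?_⟩
  have hz0 := ne_zero_of_mem_ray hz
  have hn : ‖w / z - 1‖ ≤ min (ε / 2) (1 / 2) := by
    rw [div_sub_one hz0, norm_div, div_le_iff₀ (norm_pos_iff.2 hz0)]
    exact hw
  have hq : w / z ≠ 0 := by
    intro h0
    rw [h0, zero_sub, norm_neg, norm_one] at hn
    linarith [hn.trans (min_le_right _ _)]
  have harg := h (x := w / z) (by
    rw [dist_eq_norm]; linarith [hn.trans (min_le_left _ _)])
  rw [Complex.arg_one, Real.dist_eq, sub_zero, abs_lt] at harg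
  have hπ := Real.pi_pos
  obtain ⟨s, hs, hs'⟩ := mem_ray_arg hq
  obtain ⟨r, hr, hz'⟩ := hz
  have h1 : (w / z).arg / Real.pi < δ := by rw [div_lt_iff₀ hπ]; linarith
  have h2 : -δ < (w / z).arg / Real.pi := by rw [lt_div_iff₀ hπ]; linarith
  generalize (w / z).arg / Real.pi = θ at hs' h1 h2
  refine ⟨φ + θ, ⟨by linarith, by linarith⟩, r * s, by positivity, ?_⟩
  rw [← mul_div_cancel₀ w hz0, hs']
  nth_rewrite 1 [hz']
  rw [Complex.ofReal_add, mul_add, Complex.exp_add]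
  push_cast
  ring

end WeakStab

namespace WeakStab

/-! ### Central charges -/

section Lattice

variable {Γ : Type w} [AddCommGroup Γ] {L : FilteredLattice Γ}

theorem FilteredLattice.not_mem_of_lt_level {v : Γ} {k : Fin (L.N + 1)} (hk : k < L.level v) :
    v ∉ L.sub k.succ :=
  (L.exists_level v).choose_spec.2 k hk

theorem FilteredLattice.level_le {v : Γ} {k : Fin (L.N + 1)} (hk : v ∈ L.sub k.succ) :
    L.level v ≤ k :=
  not_lt.1 fun h => FilteredLattice.not_mem_of_lt_level h hk

theorem CentralCharge.eval_eq_of_level_eq (Z : CentralCharge L) {v : Γ} {m : Fin (L.N + 1)}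
    (hv : v ∈ L.sub m.succ) (h : L.level v = m) :
    Z.eval v = Z m (QuotientAddGroup.mk ⟨v, hv⟩) := by
  subst h
  rfl

theorem CentralCharge.apply_mk_eq_zero (Z : CentralCharge L) {v : Γ} {m : Fin (L.N + 1)}
    (hv : v ∈ L.sub m.succ) (h : L.level v < m) :
    Z m (QuotientAddGroup.mk ⟨v, hv⟩) = 0 := by
  have h1 : (QuotientAddGroup.mk ⟨v, hv⟩ : L.Gr m) = 0 := by
    rw [QuotientAddGroup.eq_zero_iff, AddSubgroup.mem_addSubgroupOf]
    exact L.strictMono.monotone (show (L.level v).succ ≤ m.castSucc from h) (L.mem_level v)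
  rw [h1, map_zero]

/-- An element of lower level dies in `ℍ_m`, so a nonzero value there certifies that the level is
`m`. -/
theorem CentralCharge.eval_eq_of_ne_zero (Z : CentralCharge L) {v : Γ} {m : Fin (L.N + 1)}
    (hv : v ∈ L.sub m.succ) (h : Z m (QuotientAddGroup.mk ⟨v, hv⟩) ≠ 0) :
    Z.eval v = Z m (QuotientAddGroup.mk ⟨v, hv⟩) :=
  Z.eval_eq_of_level_eq hv <| (FilteredLattice.level_le hv).eq_of_not_lt
    fun hlt => h (Z.apply_mk_eq_zero hv hlt)

theorem CentralCharge.eval_neg (Z : CentralCharge L) {v : Γ} (h : Z.eval v ≠ 0) :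
    Z.eval (-v) = -Z.eval v := by
  have h1 : Z (L.level v) (QuotientAddGroup.mk ⟨-v, neg_mem (L.mem_level v)⟩) = -Z.eval v :=
    map_neg (Z (L.level v)) (L.cls v)
  rw [← h1]
  exact Z.eval_eq_of_ne_zero _ (by rw [h1]; exact neg_ne_zero.2 h)

/-- Additively closed sets of nonzero complex numbers are stable under the (in general not
additive) map `Z.eval`. -/
theorem CentralCharge.eval_add_mem (Z : CentralCharge L) {S : Set ℂ}
    (hS : ∀ z ∈ S, ∀ w ∈ S, z + w ∈ S) (h0 : (0 : ℂ) ∉ S) {v w : Γ} (hv : Z.eval v ∈ S)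
    (hw : Z.eval w ∈ S) : Z.eval (v + w) ∈ S := by
  wlog hle : L.level v ≤ L.level w generalizing v w
  · rw [add_comm]
    exact this hw hv (not_le.1 hle).le
  have hv' : v ∈ L.sub (L.level w).succ :=
    L.strictMono.monotone (Fin.succ_le_succ_iff.2 hle) (L.mem_level v)
  have h1 : Z (L.level w) (QuotientAddGroup.mk ⟨v + w, add_mem hv' (L.mem_level w)⟩) =
      Z (L.level w) (QuotientAddGroup.mk ⟨v, hv'⟩) + Z.eval w :=
    map_add (Z (L.level w)) (QuotientAddGroup.mk ⟨v, hv'⟩ : L.Gr (L.level w)) (L.cls w)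
  have h2 : Z (L.level w) (QuotientAddGroup.mk ⟨v, hv'⟩) + Z.eval w ∈ S := by
    -- For different levels only the higher one contributes; for equal levels the two values add up.
    rcases hle.lt_or_eq with hlt | heq
    · rwa [Z.apply_mk_eq_zero hv' hlt, zero_add]
    · rw [← Z.eval_eq_of_level_eq hv' heq]
      exact hS _ hv _ hw
  rw [← h1] at h2
  rwa [Z.eval_eq_of_ne_zero _ fun h => h0 (h ▸ h2)]

theorem CentralCharge.continuous_apply (i : Fin (L.N + 1)) (x : L.Gr i) :
    Continuous fun Z : CentralCharge L => Z i x := by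
  have h : Continuous fun (Z : CentralCharge L) (i : Fin (L.N + 1)) (x : L.Gr i) => Z i x :=
    continuous_induced_dom
  exact (_root_.continuous_apply x).comp ((_root_.continuous_apply i).comp h)

theorem CentralCharge.continuous_eval (v : Γ) :
    Continuous fun Z : CentralCharge L => Z.eval v :=
  CentralCharge.continuous_apply (L.level v) (L.cls v)

/-- A linear form on a finite-dimensional real space is bounded with respect to any norm. -/
theorem exists_linearMap_le_seminorm {V : Type*} [AddCommGroup V] [Module ℝ V]
    [FiniteDimensional ℝ V] (p : Seminorm ℝ V) (hp : ∀ x, p x = 0 → x = 0) (f : V →ₗ[ℝ] ℝ) :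
    ∃ C : ℝ, 0 ≤ C ∧ ∀ x, |f x| ≤ C * p x := by
  let N : AddGroupNorm V := { p.toAddGroupSeminorm with eq_zero_of_map_eq_zero' := hp }
  let _ : NormedAddCommGroup V := N.toNormedAddCommGroup
  let _ : NormedSpace ℝ V := ⟨fun a x => (map_smul_eq_mul p a x).le⟩
  exact ⟨‖LinearMap.toContinuousLinearMap f‖, norm_nonneg _,
    fun x => (LinearMap.toContinuousLinearMap f).le_opNorm x⟩

/-- Convergence in `∏_i ℍ_i^∨` is convergence in the operator norms. -/
theorem CentralCharge.eventually_norm_sub_le [Module.Finite ℤ Γ] (Z₀ : CentralCharge L) {ε : ℝ}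
    (hε : 0 < ε) : ∀ᶠ Z : CentralCharge L in 𝓝 Z₀, ∀ (i : Fin (L.N + 1)) (x : L.Gr i),
      ‖Z i x - Z₀ i x‖ ≤ ε * L.nrm i ((1 : ℝ) ⊗ₜ[ℤ] x) := by
  rw [Filter.eventually_all]
  intro i
  have := L.free i
  have : Module.Finite ℤ (L.sub i.succ) :=
    inferInstanceAs (Module.Finite ℤ (AddSubgroup.toIntSubmodule (L.sub i.succ)))
  have : Module.Finite ℤ (L.Gr i) :=
    Module.Finite.of_surjective (QuotientAddGroup.mk' _).toIntLinearMap
      (QuotientAddGroup.mk'_surjective _)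
  let b := Module.Free.chooseBasis ℤ (L.Gr i)
  choose C hC0 hC using fun k => exists_linearMap_le_seminorm (L.nrm i) (L.nrm_eq_zero i)
    ((b.baseChange ℝ).coord k)
  have hC' : ∀ k x, |(b.repr x k : ℝ)| ≤ C k * L.nrm i ((1 : ℝ) ⊗ₜ[ℤ] x) := fun k x => by
    have := hC k ((1 : ℝ) ⊗ₜ[ℤ] x)
    simpa [Module.Basis.baseChange_repr_tmul] using this
  -- The summand 1 keeps the denominator positive, and `η * ∑ k, C k ≤ ε`.
  set η : ℝ := ε / (1 + ∑ k, C k) with hη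
  have hsum : 0 ≤ ∑ k, C k := Finset.sum_nonneg fun k _ => hC0 k
  have hη0 : 0 < η := by positivity
  have hev : ∀ᶠ Z : CentralCharge L in 𝓝 Z₀, ∀ k, ‖Z i (b k) - Z₀ i (b k)‖ < η := by
    rw [Filter.eventually_all]
    intro k
    have := Metric.tendsto_nhds.1 ((CentralCharge.continuous_apply i (b k)).tendsto Z₀) η hη0
    simpa only [dist_eq_norm] using this
  filter_upwards [hev] with Z hZ x
  have hx : Z i x - Z₀ i x = ∑ k, (b.repr x k : ℂ) * (Z i (b k) - Z₀ i (b k)) := by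
    have h1 : ∀ g : L.Gr i →+ ℂ, g x = ∑ k, (b.repr x k : ℂ) * g (b k) := fun g => by
      conv_lhs => rw [← b.sum_repr x]
      simp only [map_sum, map_zsmul, zsmul_eq_mul]
    rw [h1 (Z i), h1 (Z₀ i), ← Finset.sum_sub_distrib]
    simp only [mul_sub]
  have hn : 0 ≤ L.nrm i ((1 : ℝ) ⊗ₜ[ℤ] x) := apply_nonneg _ _
  calc ‖Z i x - Z₀ i x‖ ≤ ∑ k, C k * L.nrm i ((1 : ℝ) ⊗ₜ[ℤ] x) * η := by
        rw [hx]
        refine (norm_sum_le _ _).trans (Finset.sum_le_sum fun k _ => ?_)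
        rw [norm_mul]
        refine mul_le_mul ?_ (hZ k).le (norm_nonneg _) (mul_nonneg (hC0 k) hn)
        simpa using hC' k x
    _ = (η * ∑ k, C k) * L.nrm i ((1 : ℝ) ⊗ₜ[ℤ] x) := by
        rw [← Finset.sum_mul, ← Finset.sum_mul]; ring
    _ ≤ ε * L.nrm i ((1 : ℝ) ⊗ₜ[ℤ] x) := by
        refine mul_le_mul_of_nonneg_right ?_ hn
        rw [hη, div_mul_eq_mul_div, div_le_iff₀ (by positivity)]
        nlinarith

end Lattice

end WeakStab

namespace WeakStab

variable {D : Type u} [Category.{v} D] [HasZeroObject D] [HasShift D ℤ] [Preadditive D]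
  [∀ n : ℤ, (shiftFunctor D n).Additive] [Pretriangulated D]

/-! ### Exact sequences of a distinguished triangle -/

section Exact

variable {X Y Z W : D} {f : X ⟶ Y} {g : Y ⟶ Z} {h : Z ⟶ X⟦(1 : ℤ)⟧}

theorem exists_eq_comp_of_mor₂_comp (hT : Triangle.mk f g h ∈ distTriang D)
    (u : Z ⟶ W) (hu : g ≫ u = 0) : ∃ v, u = h ≫ v :=
  Triangle.yoneda_exact₃ _ hT u hu

theorem exists_eq_comp_of_comp_mor₁_shift (hT : Triangle.mk f g h ∈ distTriang D)
    (u : W ⟶ X⟦(1 : ℤ)⟧)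
    (hu : u ≫ (shiftFunctor D (1 : ℤ)).map f = 0) : ∃ v, u = v ≫ h :=
  Triangle.coyoneda_exact₁ _ hT u hu

end Exact

/-! ### Extension closures and towers -/

theorem extClosure_le {S Q : ObjectProperty D} (hS : S ≤ Q) (h0 : ∀ E, IsZero E → Q E)
    (hext : ∀ T ∈ distTriang D, Q T.obj₁ → Q T.obj₃ → Q T.obj₂) : extClosure S ≤ Q := by
  intro E hE
  induction hE with
  | zero E h => exact h0 E h
  | of E h => exact hS E h
  | ext T hT _ _ h₁ h₃ => exact hext T hT h₁ h₃

open ZeroObject in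
theorem extClosure_of_iso {S : ObjectProperty D} {X Y : D} (e : X ≅ Y) (h : extClosure S X) :
    extClosure S Y :=
  extClosure.ext (Triangle.mk e.hom (0 : Y ⟶ 0) 0)
    ((Triangle.distinguished_iff_of_isZero₃ _ (isZero_zero D)).2 (inferInstanceAs (IsIso e.hom)))
    h (extClosure.zero _ (isZero_zero D))

theorem Tower.extClosure_obj {E : D} {n : ℕ} (T : Tower E n) (j : Fin (n + 2)) :
    extClosure (fun X => ∃ k, X = T.factor k) (T.obj j) := by
  induction j using Fin.induction with
  | zero => exact extClosure.zero _ T.isZero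
  | succ i ih => exact extClosure.ext _ (T.distinguished i) ih (extClosure.of _ ⟨i, rfl⟩)

theorem Tower.extClosure_top {E : D} {n : ℕ} (T : Tower E n) :
    extClosure (fun X => ∃ k, X = T.factor k) E :=
  extClosure_of_iso T.topIso (T.extClosure_obj _)

/-- The last step of a tower. -/
theorem Tower.exists_last_triangle {E : D} {n : ℕ} (T : Tower E n) :
    ∃ (i : T.obj (Fin.last n).castSucc ⟶ E) (π : E ⟶ T.factor (Fin.last n))
      (δ : T.factor (Fin.last n) ⟶ (T.obj (Fin.last n).castSucc)⟦(1 : ℤ)⟧),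
      Triangle.mk i π δ ∈ distTriang D := by
  let e : T.obj (Fin.last n).succ ≅ E := T.topIso
  refine ⟨T.incl _ ≫ e.hom, e.inv ≫ T.proj _, T.conn _,
    isomorphic_distinguished _ (T.distinguished (Fin.last n)) _ ?_⟩
  refine Triangle.isoMk _ _ (Iso.refl _) e.symm (Iso.refl _) ?_ ?_ ?_
  · change (T.incl _ ≫ e.hom) ≫ e.inv = 𝟙 _ ≫ T.incl _
    simp
  · change (e.inv ≫ T.proj _) ≫ 𝟙 _ = e.inv ≫ T.proj _
    simp
  · change T.conn _ ≫ (shiftFunctor D (1 : ℤ)).map (𝟙 _) = 𝟙 _ ≫ T.conn _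
    simp

/-- The first factor of a tower maps to its top, and this map is a monomorphism as far as objects
`W` without maps from `W[1]` to the factors can see. -/
theorem Tower.exists_first_map {E : D} {n : ℕ} (T : Tower E n) :
    ∃ ι : T.factor 0 ⟶ E, ∀ W : D, (∀ k (f : W⟦(1 : ℤ)⟧ ⟶ T.factor k), f = 0) →
      ∀ f : W ⟶ T.factor 0, f ≫ ι = 0 → f = 0 := by
  have key : ∀ j : Fin (n + 1), ∃ ι : T.factor 0 ⟶ T.obj j.succ,
      ∀ W : D, (∀ k (f : W⟦(1 : ℤ)⟧ ⟶ T.factor k), f = 0) →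
        ∀ f : W ⟶ T.factor 0, f ≫ ι = 0 → f = 0 := by
    intro j
    induction j using Fin.induction with
    | zero =>
      have : IsIso (T.proj 0) :=
        (Triangle.isZero₁_iff_isIso₂ _ (T.distinguished 0)).1 T.isZero
      refine ⟨inv (T.proj 0), fun W _ f hf => ?_⟩
      rw [← cancel_mono (inv (T.proj 0)), zero_comp]
      exact hf
    | succ i ih =>
      obtain ⟨ι, hι⟩ := ih
      refine ⟨ι ≫ T.incl i.succ, fun W hW f hf => hι W hW f ?_⟩
      have h1 : (shiftFunctor D (1 : ℤ)).map (f ≫ ι) ≫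
          (shiftFunctor D (1 : ℤ)).map (T.incl i.succ) = 0 := by
        rw [← Functor.map_comp, Category.assoc, hf, Functor.map_zero]
      -- A map killed by the next inclusion factors, after a shift, through a map from `W[1]` to the
      -- next factor, and such maps vanish.
      obtain ⟨g, hg⟩ := exists_eq_comp_of_comp_mor₁_shift (T.distinguished i.succ) _ h1
      rw [hW _ g, zero_comp] at hg
      exact (shiftFunctor D (1 : ℤ)).map_injective (hg.trans (Functor.map_zero _ _ _).symm)
  obtain ⟨ι, hι⟩ := key (Fin.last n)
  let e : T.obj (Fin.last n).succ ≅ E := T.topIso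
  refine ⟨ι ≫ e.hom, fun W hW f hf => hι W hW f ?_⟩
  rw [← cancel_mono e.hom, zero_comp, Category.assoc, hf]

/-! ### Bounds on the phases of an object -/

/-- All phases of `E` are at least `a`, formulated by orthogonality. -/
def Slicing.PhaseGE (P : Slicing D) (a : ℝ) (E : D) : Prop :=
  ∀ ψ < a, ∀ W, P.P ψ W → ∀ f : E ⟶ W, f = 0

/-- All phases of `E` are at most `a`, formulated by orthogonality. -/
def Slicing.PhaseLE (P : Slicing D) (a : ℝ) (E : D) : Prop :=
  ∀ ψ > a, ∀ W, P.P ψ W → ∀ f : W ⟶ E, f = 0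

namespace Slicing

variable (P : Slicing D)

theorem phaseGE_of_isZero {a : ℝ} {E : D} (h : IsZero E) : P.PhaseGE a E :=
  fun _ _ _ _ _ => h.eq_of_src _ _

theorem phaseLE_of_isZero {a : ℝ} {E : D} (h : IsZero E) : P.PhaseLE a E :=
  fun _ _ _ _ _ => h.eq_of_tgt _ _

theorem phaseGE_ext {a : ℝ} (T : Triangle D) (hT : T ∈ distTriang D) (h₁ : P.PhaseGE a T.obj₁)
    (h₃ : P.PhaseGE a T.obj₃) : P.PhaseGE a T.obj₂ := by
  intro ψ hψ W hW f
  obtain ⟨g, rfl⟩ := Triangle.yoneda_exact₂ T hT f (h₁ ψ hψ W hW _)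
  rw [h₃ ψ hψ W hW g, comp_zero]

theorem phaseLE_ext {a : ℝ} (T : Triangle D) (hT : T ∈ distTriang D) (h₁ : P.PhaseLE a T.obj₁)
    (h₃ : P.PhaseLE a T.obj₃) : P.PhaseLE a T.obj₂ := by
  intro ψ hψ W hW f
  obtain ⟨g, rfl⟩ := Triangle.coyoneda_exact₂ T hT f (h₃ ψ hψ W hW _)
  rw [h₁ ψ hψ W hW g, zero_comp]

theorem phaseGE_extClosure {a : ℝ} {S : ObjectProperty D} (hS : ∀ E, S E → P.PhaseGE a E) {E : D}
    (hE : extClosure S E) : P.PhaseGE a E :=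
  extClosure_le (Q := P.PhaseGE a) hS (fun _ => P.phaseGE_of_isZero)
    (fun T hT => P.phaseGE_ext T hT) E hE

theorem phaseLE_extClosure {a : ℝ} {S : ObjectProperty D} (hS : ∀ E, S E → P.PhaseLE a E) {E : D}
    (hE : extClosure S E) : P.PhaseLE a E :=
  extClosure_le (Q := P.PhaseLE a) hS (fun _ => P.phaseLE_of_isZero)
    (fun T hT => P.phaseLE_ext T hT) E hE

variable {P}

theorem PhaseGE.mono {a b : ℝ} {E : D} (h : P.PhaseGE a E) (hab : b ≤ a) : P.PhaseGE b E :=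
  fun ψ hψ => h ψ (hψ.trans_le hab)

theorem PhaseLE.mono {a b : ℝ} {E : D} (h : P.PhaseLE a E) (hab : a ≤ b) : P.PhaseLE b E :=
  fun ψ hψ => h ψ (hab.trans_lt hψ)

theorem PhaseGE.of_iso {a : ℝ} {E F : D} (h : P.PhaseGE a E) (e : E ≅ F) : P.PhaseGE a F := by
  intro ψ hψ W hW f
  rw [← cancel_epi e.hom, comp_zero]
  exact h ψ hψ W hW _

theorem PhaseLE.of_iso {a : ℝ} {E F : D} (h : P.PhaseLE a E) (e : E ≅ F) : P.PhaseLE a F := by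
  intro ψ hψ W hW f
  rw [← cancel_mono e.inv, zero_comp]
  exact h ψ hψ W hW _

theorem phaseGE_of_mem {φ a : ℝ} {E : D} (h : P.P φ E) (ha : a ≤ φ) : P.PhaseGE a E :=
  fun ψ hψ W hW f => P.hom_eq_zero φ ψ E W h hW (hψ.trans_le ha) f

theorem phaseLE_of_mem {φ a : ℝ} {E : D} (h : P.P φ E) (ha : φ ≤ a) : P.PhaseLE a E :=
  fun ψ hψ W hW f => P.hom_eq_zero ψ φ W E hW h (ha.trans_lt hψ) f

theorem mem_of_iso {φ : ℝ} {E F : D} (h : P.P φ E) (e : E ≅ F) : P.P φ F :=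
  (P.closedUnderIso φ).of_iso e h

theorem mem_shift {φ : ℝ} {E : D} (h : P.P φ E) : P.P (φ + 1) (E⟦(1 : ℤ)⟧) :=
  (P.shift_iff φ E).2 h

/-- The isomorphism `E[-1][1] ≅ E`. -/
def shiftNegShiftIso (E : D) : E⟦(-1 : ℤ)⟧⟦(1 : ℤ)⟧ ≅ E :=
  (shiftFunctorCompIsoId D (-1 : ℤ) 1 (by simp)).app E

theorem mem_shift_neg {φ : ℝ} {E : D} (h : P.P φ E) : P.P (φ - 1) (E⟦(-1 : ℤ)⟧) := by
  rw [← P.shift_iff, sub_add_cancel]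
  exact mem_of_iso h (shiftNegShiftIso E).symm

theorem phaseGE_shift_iff {a : ℝ} {E : D} : P.PhaseGE (a + 1) (E⟦(1 : ℤ)⟧) ↔ P.PhaseGE a E := by
  constructor
  · intro h ψ hψ W hW f
    exact (shiftFunctor D (1 : ℤ)).map_injective
      ((h (ψ + 1) (by linarith) _ (mem_shift hW) _).trans (Functor.map_zero _ _ _).symm)
  · intro h ψ hψ W hW f
    obtain ⟨g, hg⟩ := (shiftFunctor D (1 : ℤ)).map_surjective (f ≫ (shiftNegShiftIso W).inv)
    rw [← cancel_mono (shiftNegShiftIso W).inv, ← hg, h (ψ - 1) (by linarith) _ (mem_shift_neg hW) g,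
      Functor.map_zero, zero_comp]

theorem phaseLE_shift_iff {a : ℝ} {E : D} : P.PhaseLE (a + 1) (E⟦(1 : ℤ)⟧) ↔ P.PhaseLE a E := by
  constructor
  · intro h ψ hψ W hW f
    exact (shiftFunctor D (1 : ℤ)).map_injective
      ((h (ψ + 1) (by linarith) _ (mem_shift hW) _).trans (Functor.map_zero _ _ _).symm)
  · intro h ψ hψ W hW f
    obtain ⟨g, hg⟩ := (shiftFunctor D (1 : ℤ)).map_surjective ((shiftNegShiftIso W).hom ≫ f)
    rw [← cancel_epi (shiftNegShiftIso W).hom, ← hg, h (ψ - 1) (by linarith) _ (mem_shift_neg hW) g,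
      Functor.map_zero, comp_zero]

theorem _root_.WeakStab.HNFiltration.phase_le_first {E : D} (h : HNFiltration P.P E)
    (k : Fin (h.n + 1)) : h.phase k ≤ h.phase 0 :=
  h.strictAnti.antitone (Fin.zero_le k)

theorem _root_.WeakStab.HNFiltration.last_le_phase {E : D} (h : HNFiltration P.P E)
    (k : Fin (h.n + 1)) : h.phase (Fin.last _) ≤ h.phase k :=
  h.strictAnti.antitone (Fin.le_last k)

theorem phaseGE_obj {E : D} (h : HNFiltration P.P E) (j : Fin (h.n + 2)) :
    P.PhaseGE (h.phase (Fin.last _)) (h.tower.obj j) :=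
  P.phaseGE_extClosure (by rintro _ ⟨k, rfl⟩; exact phaseGE_of_mem (h.mem k) (h.last_le_phase k))
    (h.tower.extClosure_obj j)

/-- If all phases of `E` were below that of the first factor, its map to `E` would vanish. This map
is injective on maps from the factor itself, whose shift has larger phase than every factor, so the
identity of the factor would be zero. -/
theorem phaseLE_iff_first {E : D} (h : HNFiltration P.P E) {a : ℝ} :
    P.PhaseLE a E ↔ h.phase 0 ≤ a := by
  refine ⟨fun hE => ?_, fun ha => P.phaseLE_extClosure ?_ h.tower.extClosure_top⟩
  · by_contra! hlt
    obtain ⟨ι, hι⟩ := h.tower.exists_first_map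
    refine h.ne_zero 0 ((IsZero.iff_id_eq_zero _).2 (hι _ (fun k f => ?_) _ ?_))
    · exact P.hom_eq_zero _ _ _ _ (mem_shift (h.mem 0)) (h.mem k)
        (by linarith [h.phase_le_first k]) f
    · rw [Category.id_comp]
      exact hE _ hlt _ (h.mem 0) ι
  · rintro _ ⟨k, rfl⟩
    exact phaseLE_of_mem (h.mem k) ((h.phase_le_first k).trans ha)

/-- Dually, if the projection to the last factor vanished, the identity of that factor would factor
through `K[1]`, with `K` the previous step. The phases of `K[1]` exceed that of the factor, so the
identity would be zero. -/
theorem phaseGE_iff_last {E : D} (h : HNFiltration P.P E) {a : ℝ} :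
    P.PhaseGE a E ↔ a ≤ h.phase (Fin.last _) := by
  refine ⟨fun hE => ?_, fun ha => P.phaseGE_extClosure ?_ h.tower.extClosure_top⟩
  · by_contra! hlt
    obtain ⟨i, π, δ, hT⟩ := h.tower.exists_last_triangle
    obtain ⟨g, hg⟩ := exists_eq_comp_of_mor₂_comp hT (𝟙 (h.tower.factor (Fin.last _)))
      ((Category.comp_id _).trans (hE _ hlt _ (h.mem _) π))
    refine h.ne_zero (Fin.last _) ((IsZero.iff_id_eq_zero _).2 (hg.trans ?_))
    rw [(phaseGE_shift_iff.2 (phaseGE_obj h _)) _ (lt_add_one _) _ (h.mem _) g, comp_zero]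
  · rintro _ ⟨k, rfl⟩
    exact phaseGE_of_mem (h.mem k) (ha.trans (h.last_le_phase k))

/-- Orthogonality makes no reference to the chosen filtration in `phaseMinus`, so everything below
can be argued with `PhaseGE` and `PhaseLE`. -/
theorem le_phaseMinus_iff {E : D} (hE : ¬ IsZero E) {a : ℝ} :
    a ≤ P.phaseMinus E hE ↔ P.PhaseGE a E :=
  (phaseGE_iff_last _).symm

theorem phasePlus_le_iff {E : D} (hE : ¬ IsZero E) {a : ℝ} :
    P.phasePlus E hE ≤ a ↔ P.PhaseLE a E :=
  (phaseLE_iff_first _).symm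

theorem hom_eq_zero_of_phase {a b : ℝ} (hab : b < a) {X Y : D} (hX : P.PhaseGE a X)
    (hY : P.PhaseLE b Y) (f : X ⟶ Y) : f = 0 := by
  by_cases h0 : IsZero Y
  · exact h0.eq_of_tgt _ _
  obtain ⟨h⟩ := P.exists_hn Y h0
  refine extClosure_le (Q := fun Y => ∀ f : X ⟶ Y, f = 0) ?_ (fun E hE f => hE.eq_of_tgt _ _) ?_
    Y h.tower.extClosure_top f
  · rintro _ ⟨k, rfl⟩
    exact hX _ (((h.phase_le_first k).trans ((phaseLE_iff_first h).1 hY)).trans_lt hab) _ (h.mem k)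
  · intro T hT h₁ h₃ f
    obtain ⟨g, rfl⟩ := Triangle.coyoneda_exact₂ T hT f (h₃ _)
    rw [h₁ g, zero_comp]

/-- A bound for the generalized metric, in terms of semistable objects of one of the slicings. -/
theorem edist_le {P Q : Slice D} {δ : ℝ}
    (h : ∀ φ E, P.1.P φ E → Q.1.PhaseLE (φ + δ) E ∧ Q.1.PhaseGE (φ - δ) E) :
    edist P Q ≤ ENNReal.ofReal δ := by
  have key : ∀ x y : ℝ, x ≤ y + δ → y ≤ x + δ → edist x y ≤ ENNReal.ofReal δ := by
    intro x y h1 h2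
    rw [edist_dist, Real.dist_eq]
    exact ENNReal.ofReal_le_ofReal (abs_sub_le_iff.2 ⟨by linarith, by linarith⟩)
  refine iSup_le fun ⟨E, hE⟩ => max_le (key _ _ ?_ ?_) (key _ _ ?_ ?_)
  · rw [← sub_le_iff_le_add, le_phaseMinus_iff]
    obtain ⟨hn⟩ := P.1.exists_hn E hE
    refine Q.1.phaseGE_extClosure ?_ hn.tower.extClosure_top
    rintro _ ⟨k, rfl⟩
    refine (h _ _ (hn.mem k)).2.mono ?_
    have := (phaseGE_iff_last hn).1 ((le_phaseMinus_iff (P := P.1) hE).1 le_rfl)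
    linarith [hn.last_le_phase k]
  -- The reverse inequality needs no information on `Q`-semistable objects: it suffices to test `E`
  -- against `P`-semistable objects, whose `Q`-phases are controlled.
  · rw [← sub_le_iff_le_add, le_phaseMinus_iff]
    intro ψ hψ W hW f
    exact hom_eq_zero_of_phase (by linarith : ψ + δ < Q.1.phaseMinus E hE)
      ((le_phaseMinus_iff hE).1 le_rfl) (h _ _ hW).1 f
  · rw [phasePlus_le_iff]
    intro ψ hψ W hW f
    exact hom_eq_zero_of_phase (by linarith : Q.1.phasePlus E hE < ψ - δ)
      (h _ _ hW).2 ((phasePlus_le_iff hE).1 le_rfl) f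
  · rw [phasePlus_le_iff]
    obtain ⟨hn⟩ := P.1.exists_hn E hE
    refine Q.1.phaseLE_extClosure ?_ hn.tower.extClosure_top
    rintro _ ⟨k, rfl⟩
    refine (h _ _ (hn.mem k)).1.mono ?_
    have := (phaseLE_iff_first hn).1 ((phasePlus_le_iff (P := P.1) hE).1 le_rfl)
    linarith [hn.phase_le_first k]

/-- If `P((0, 1])` lies in `P₀([0, 1])` then `P((n, n + 1])` lies in `P₀([n, n + 1])`. -/
theorem phase_bounds_of_unit_interval {P₀ P : Slicing D}
    (h : ∀ φ ∈ Set.Ioc (0 : ℝ) 1, ∀ E, P.P φ E → P₀.PhaseGE 0 E ∧ P₀.PhaseLE 1 E) (n : ℤ) :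
    ∀ φ ∈ Set.Ioc (n : ℝ) (n + 1), ∀ E, P.P φ E → P₀.PhaseGE n E ∧ P₀.PhaseLE (n + 1) E := by
  induction n using Int.induction_on with
  | zero => simpa using h
  | succ n ih =>
    rintro φ ⟨h1, h2⟩ E hE
    push_cast at h1 h2 ih ⊢
    obtain ⟨h3, h4⟩ := ih (φ - 1) ⟨by linarith, by linarith⟩ _ (mem_shift_neg hE)
    exact ⟨(phaseGE_shift_iff.2 h3).of_iso (shiftNegShiftIso E),
      (phaseLE_shift_iff.2 h4).of_iso (shiftNegShiftIso E)⟩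
  | pred n ih =>
    rintro φ ⟨h1, h2⟩ E hE
    push_cast at h1 h2 ih ⊢
    obtain ⟨h3, h4⟩ := ih (φ + 1) ⟨by linarith, by linarith⟩ _ (mem_shift hE)
    refine ⟨phaseGE_shift_iff.1 (by simpa using h3), phaseLE_shift_iff.1 (by simpa using h4)⟩

end Slicing

end WeakStab

namespace WeakStab

section K0

variable {D : Type u} [Category.{v} D] [HasZeroObject D] [HasShift D ℤ] [Preadditive D]
  [∀ n : ℤ, (shiftFunctor D n).Additive] [Pretriangulated D]

/-! ### Classes in the Grothendieck group -/

theorem K0.of_triangle (T : Triangle D) (hT : T ∈ distTriang D) :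
    K0.of T.obj₂ = K0.of T.obj₁ + K0.of T.obj₃ := by
  have h : FreeAbelianGroup.of T.obj₂ - (FreeAbelianGroup.of T.obj₁ + FreeAbelianGroup.of T.obj₃) ∈
      AddSubgroup.closure {x : FreeAbelianGroup D | ∃ T : Triangle D, T ∈ distTriang D ∧ x =
        FreeAbelianGroup.of T.obj₂ - FreeAbelianGroup.of T.obj₁ - FreeAbelianGroup.of T.obj₃} :=
    AddSubgroup.subset_closure ⟨T, hT, by abel⟩
  exact QuotientAddGroup.eq_iff_sub_mem.2 h

theorem K0.of_isZero {E : D} (h : IsZero E) : K0.of E = 0 := by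
  have h1 := K0.of_triangle (Triangle.mk (0 : E ⟶ E) (0 : E ⟶ E) 0)
    ((Triangle.distinguished_iff_of_isZero₃ _ h).2 ⟨0, h.eq_of_src _ _, h.eq_of_src _ _⟩)
  exact left_eq_add.1 h1

theorem K0.of_iso {E F : D} (e : E ≅ F) : K0.of F = K0.of E := by
  obtain ⟨Z, hZ⟩ := HasZeroObject.zero (C := D)
  have hz : IsZero Z := ⟨hZ.unique_to, hZ.unique_from⟩
  have h1 := K0.of_triangle (Triangle.mk e.hom (0 : F ⟶ Z) 0)
    ((Triangle.distinguished_iff_of_isZero₃ _ hz).2 (inferInstanceAs (IsIso e.hom)))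
  refine h1.trans ?_
  change K0.of E + K0.of Z = _
  rw [K0.of_isZero hz, add_zero]

open ZeroObject in
theorem K0.of_shift (E : D) : K0.of (E⟦(1 : ℤ)⟧) = -K0.of E := by
  have h1 := K0.of_triangle _ (contractible_distinguished₂ E)
  change K0.of (0 : D) = K0.of E + K0.of (E⟦(1 : ℤ)⟧) at h1
  rw [K0.of_isZero (isZero_zero D)] at h1
  exact (neg_eq_of_add_eq_zero_right h1.symm).symm

end K0

section Stability

variable {D : Type u} [Category.{v} D] [HasZeroObject D] [HasShift D ℤ] [Preadditive D]
  [∀ n : ℤ, (shiftFunctor D n).Additive] [Pretriangulated D]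
  {Γ : Type w} [AddCommGroup Γ] {L : FilteredLattice Γ} {cl : K0 D →+ Γ}

/-! ### Comparison of slicings -/

/-- Classes add up along triangles and a sector of width less than 1 is closed under sums. Zero
objects have to be carried along separately in the induction. -/
theorem CentralCharge.onObj_mem_sector_of_extClosure (Z : CentralCharge L) {a b : ℝ}
    (hab : b - a < 1) {S : ObjectProperty D}
    (hS : ∀ E, S E → ¬ IsZero E → Z.onObj cl E ∈ sector a b) {E : D} (hE : extClosure S E)
    (h0 : ¬ IsZero E) : Z.onObj cl E ∈ sector a b := by
  refine (extClosure_le (Q := fun E => IsZero E ∨ Z.onObj cl E ∈ sector a b)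
    (fun E h => or_iff_not_imp_left.2 (hS E h)) (fun _ => Or.inl) ?_ E hE).resolve_left h0
  intro T hT h₁ h₃
  have hK : cl (K0.of T.obj₂) = cl (K0.of T.obj₁) + cl (K0.of T.obj₃) := by
    rw [K0.of_triangle T hT, map_add]
  rcases h₁ with h₁ | h₁ <;> rcases h₃ with h₃ | h₃
  · exact Or.inl (Triangle.isZero₂_of_isZero₁₃ T hT h₁ h₃)
  · right
    rwa [CentralCharge.onObj, hK, K0.of_isZero h₁, map_zero, zero_add]
  · right
    rwa [CentralCharge.onObj, hK, K0.of_isZero h₃, map_zero, add_zero]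
  · right
    rw [CentralCharge.onObj, hK]
    exact Z.eval_add_mem (fun z hz w hw => sector_add hab hz hw)
      (fun h => ne_zero_of_mem_sector h rfl) h₁ h₃

theorem CentralCharge.onObj_mem_sector (Z : CentralCharge L) {P : Slicing D} {δ a b : ℝ}
    (hZ : ∀ φ E, P.P φ E → ¬ IsZero E → Z.onObj cl E ∈ sector (φ - δ) (φ + δ))
    (hab : b - a + 2 * δ < 1) {E : D} (h0 : ¬ IsZero E) (ha : P.PhaseGE a E)
    (hb : P.PhaseLE b E) : Z.onObj cl E ∈ sector (a - δ) (b + δ) := by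
  obtain ⟨h⟩ := P.exists_hn E h0
  refine Z.onObj_mem_sector_of_extClosure (by linarith) ?_ h.tower.extClosure_top h0
  rintro _ ⟨k, rfl⟩ hk
  obtain ⟨φ, ⟨h1, h2⟩, h3⟩ := hZ _ _ (h.mem k) hk
  have h4 := (Slicing.phaseGE_iff_last h).1 ha
  have h5 := (Slicing.phaseLE_iff_first h).1 hb
  exact ⟨φ, ⟨by linarith [h.last_le_phase k], by linarith [h.phase_le_first k]⟩, h3⟩

/-- If `P((0, 1])` lies in `P₀([0, 1])` and `Z` is compatible with `P` and almost compatible with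
`P₀`, then the slicings `P₀` and `P` are close to each other. -/
theorem Slicing.phase_bounds_of_central_charge {P₀ P : Slicing D} (Z : CentralCharge L) {δ : ℝ}
    (hδ : 0 < δ) (hδ1 : δ < 1)
    (hP : ∀ φ ∈ Set.Ioc (0 : ℝ) 1, ∀ E, P.P φ E → P₀.PhaseGE 0 E ∧ P₀.PhaseLE 1 E)
    (hZ₀ : ∀ φ E, P₀.P φ E → ¬ IsZero E → Z.onObj cl E ∈ sector (φ - δ) (φ + δ))
    (hZ : ∀ φ E, P.P φ E → ¬ IsZero E → Z.onObj cl E ∈ ray φ) {φ : ℝ} {E : D}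
    (hE : P₀.P φ E) : P.PhaseLE (φ + 2 * δ) E ∧ P.PhaseGE (φ - 2 * δ) E := by
  by_cases h0 : IsZero E
  · exact ⟨P.phaseLE_of_isZero h0, P.phaseGE_of_isZero h0⟩
  have hfloor : ∀ ψ : ℝ, ∃ n : ℤ, (n : ℝ) < ψ ∧ ψ ≤ n + 1 := fun ψ =>
    ⟨⌈ψ⌉ - 1, by push_cast; linarith [Int.ceil_lt_add_one ψ], by push_cast; linarith [Int.le_ceil ψ]⟩
  have hge : ∀ (n : ℤ) (ψ : ℝ) (X : D), P.P ψ X → (n : ℝ) < ψ → P₀.PhaseGE n X := by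
    intro n ψ X hX hn
    obtain ⟨m, hm1, hm2⟩ := hfloor ψ
    have : n < m + 1 := by exact_mod_cast hn.trans_le hm2
    exact (phase_bounds_of_unit_interval hP m ψ ⟨hm1, hm2⟩ X hX).1.mono
      (by exact_mod_cast Int.lt_add_one_iff.1 this)
  have hle : ∀ (n : ℤ) (ψ : ℝ) (X : D), P.P ψ X → ψ ≤ n + 1 → P₀.PhaseLE (n + 1) X := by
    intro n ψ X hX hn
    obtain ⟨m, hm1, hm2⟩ := hfloor ψ
    have : m < n + 1 := by exact_mod_cast hm1.trans_le hn
    exact (phase_bounds_of_unit_interval hP m ψ ⟨hm1, hm2⟩ X hX).2.mono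
      (by exact_mod_cast Int.add_one_le_iff.2 this)
  obtain ⟨h⟩ := P.exists_hn E h0
  constructor
  · rw [phaseLE_iff_first h]
    by_contra! hlt
    obtain ⟨n, hn1, hn2⟩ := hfloor (h.phase 0)
    obtain ⟨ι, hι⟩ := h.tower.exists_first_map
    have hF : P₀.PhaseGE n (h.tower.factor 0) := hge n _ _ (h.mem 0) hn1
    -- Otherwise the nonzero map from the first factor to `E` would go from larger to smaller
    -- `P₀`-phases.
    have hnφ : (n : ℝ) ≤ φ := by
      by_contra! hφn
      refine h.ne_zero 0 ((IsZero.iff_id_eq_zero _).2 (hι _ (fun k f => ?_) _ ?_))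
      · exact P.hom_eq_zero _ _ _ _ (mem_shift (h.mem 0)) (h.mem k)
          (by linarith [h.phase_le_first k]) f
      · rw [Category.id_comp]
        exact hF _ hφn _ hE ι
    -- A map `W ⟶ F` from phase `χ > φ` dies in `E`. It is already zero because `W[1]` has phase `χ
    -- + 1 > n + 1`, beyond the `P₀`-phases of all factors.
    have hF' : P₀.PhaseLE φ (h.tower.factor 0) := by
      intro χ hχ W hW f
      refine hι W (fun k g => ?_) f (P₀.hom_eq_zero _ _ _ _ hW hE hχ _)
      exact hle n _ _ (h.mem k) ((h.phase_le_first k).trans hn2) (χ + 1) (by linarith) _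
        (mem_shift hW) g
    -- From `φ + 2 * δ < h.phase 0 ≤ n + 1` one gets `φ - n + 2 * δ < 1`, the width that the sector
    -- lemma needs; this is why the bound has `2 * δ` and not `δ`. The two phases of the value
    -- differ by less than 2, so they agree.
    obtain ⟨θ, ⟨hθ1, hθ2⟩, hθ⟩ := Z.onObj_mem_sector hZ₀ (by linarith) (h.ne_zero 0) hF hF'
    have := ray_phase_unique hθ (hZ _ _ (h.mem 0) (h.ne_zero 0))
      (abs_lt.2 ⟨by linarith, by linarith⟩)
    linarith
  · rw [phaseGE_iff_last h]
    by_contra! hlt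
    obtain ⟨n, hn1, hn2⟩ := hfloor (h.phase (Fin.last _))
    obtain ⟨i, π, d, hT⟩ := h.tower.exists_last_triangle
    have hG : P₀.PhaseLE (n + 1) (h.tower.factor (Fin.last _)) := hle n _ _ (h.mem _) hn2
    have hK : P₀.PhaseGE (n + 1) ((h.tower.obj (Fin.last h.n).castSucc)⟦(1 : ℤ)⟧) := by
      refine phaseGE_shift_iff.2 (P₀.phaseGE_extClosure ?_ (h.tower.extClosure_obj _))
      rintro _ ⟨k, rfl⟩
      exact hge n _ _ (h.mem k) (hn1.trans_le (h.last_le_phase k))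
    have hnφ : φ ≤ n + 1 := by
      by_contra! hφn
      obtain ⟨g, hg⟩ := exists_eq_comp_of_mor₂_comp hT (𝟙 (h.tower.factor (Fin.last _)))
        ((Category.comp_id _).trans (hG _ hφn _ hE π))
      refine h.ne_zero (Fin.last _) ((IsZero.iff_id_eq_zero _).2 (hg.trans ?_))
      rw [(phaseGE_shift_iff.2 (phaseGE_obj h _)) _ (lt_add_one _) _ (h.mem _) g, comp_zero]
    -- A map from the last factor to phase `χ < φ` vanishes on `E`, so it factors through `K[1]`,
    -- whose `P₀`-phases are at least `n + 1 ≥ φ`.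
    have hG' : P₀.PhaseGE φ (h.tower.factor (Fin.last _)) := by
      intro χ hχ W hW f
      obtain ⟨g, rfl⟩ := exists_eq_comp_of_mor₂_comp hT f
        (P₀.hom_eq_zero _ _ _ _ hE hW hχ _)
      rw [hK χ (by linarith) W hW g, comp_zero]
    obtain ⟨θ, ⟨hθ1, hθ2⟩, hθ⟩ := Z.onObj_mem_sector hZ₀ (by linarith) (h.ne_zero _) hG' hG
    have := ray_phase_unique hθ (hZ _ _ (h.mem _) (h.ne_zero _))
      (abs_lt.2 ⟨by linarith, by linarith⟩)
    linarith

/-- Convergence in the space of weak stability conditions follows from convergence of the central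
charges if `P_t((0, 1])` lies in `P₀([0, 1])`. -/
theorem Stab.tendsto_of_phase_bounds [Module.Finite ℤ Γ] {ι : Type*} {l : Filter ι}
    {σ : ι → Stab L cl} {σ₀ : Stab L cl} (hZ : Filter.Tendsto (fun t => (σ t).Z) l (𝓝 σ₀.Z))
    (hP : ∀ᶠ t in l, ∀ φ ∈ Set.Ioc (0 : ℝ) 1, ∀ E, (σ t).P.1.P φ E →
      σ₀.P.1.PhaseGE 0 E ∧ σ₀.P.1.PhaseLE 1 E) :
    Filter.Tendsto σ l (𝓝 σ₀) := by
  rw [nhds_induced, Filter.tendsto_comap_iff]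
  refine Filter.Tendsto.prodMk_nhds (EMetric.tendsto_nhds.2 fun ε hε => ?_) hZ
  obtain ⟨r, -, hr, hrε⟩ := ENNReal.lt_iff_exists_real_btwn.1 hε
  have hr0 : 0 < r := ENNReal.ofReal_pos.1 hr
  set δ := min (r / 2) (1 / 2) with hδdef
  have hδ : 0 < δ := by positivity
  have hδr : 2 * δ ≤ r := by linarith [min_le_left (r / 2) (1 / 2)]
  have hδ1 : δ < 1 := by linarith [min_le_right (r / 2) (1 / 2)]
  obtain ⟨η, hη, hpert⟩ := exists_perturbation_bound hδ
  obtain ⟨C, hC, hsupp⟩ := σ₀.support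
  filter_upwards [hP, hZ.eventually (σ₀.Z.eventually_norm_sub_le (div_pos hη hC))] with t ht hZt
  -- The comparison is run over the semistable objects of `σ₀`, where the support property is
  -- available with a constant independent of `t`.
  rw [edist_comm]
  refine (Slicing.edist_le fun φ E hE => Slicing.phase_bounds_of_central_charge (σ t).Z hδ hδ1 ht
    ?_ (σ t).phase hE).trans_lt ((ENNReal.ofReal_le_ofReal hδr).trans_lt hrε)
  intro φ E hE h0
  refine hpert φ _ _ (σ₀.phase φ E hE h0) ?_
  calc ‖(σ t).Z.onObj cl E - σ₀.Z.onObj cl E‖ ≤ η / C * L.size (cl (K0.of E)) := hZt _ _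
    _ ≤ η / C * (C * ‖σ₀.Z.onObj cl E‖) :=
        mul_le_mul_of_nonneg_left (hsupp φ E hE h0) (by positivity)
    _ = η * ‖σ₀.Z.onObj cl E‖ := by field_simp

/-! ### Stability conditions determined by hearts -/

/-- The filtration in `A` is itself a filtration for the slicing, with phases `arg / π`: on the half
plane the principal argument is the phase in `(0, 1]`. -/
theorem Stab.IsDeterminedBy.exists_hnFiltration {σ : Stab L cl} {Z : CentralCharge L}
    {A : ObjectProperty D} (hσ : σ.IsDeterminedBy Z A) {E : D} (hE : A E) (h0 : ¬ IsZero E) :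
    ∃ h : HNFiltration σ.P.1.P E, (∀ j, A (h.tower.obj j)) ∧ (∀ k, A (h.tower.factor k)) ∧
      ∀ k, h.phase k ∈ Set.Ioc (0 : ℝ) 1 := by
  obtain ⟨n, T, hT, hss, hanti⟩ := hσ.hn E hE h0
  have harg : ∀ k, (Z.onObj cl (T.factor k)).arg / Real.pi ∈ Set.Ioc (0 : ℝ) 1 := by
    intro k
    obtain ⟨φ, hφ, hray⟩ := Set.mem_iUnion₂.1
      (hσ.weakStabilityFunction _ (hss k).1 (hss k).2.1)
    have h1 : (Z.onObj cl (T.factor k)).arg / Real.pi ≤ 1 := by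
      rw [div_le_one Real.pi_pos]
      exact Complex.arg_le_pi _
    have h2 : -1 < (Z.onObj cl (T.factor k)).arg / Real.pi := by
      rw [lt_div_iff₀ Real.pi_pos, neg_one_mul]
      exact Complex.neg_pi_lt_arg _
    have h3 := ray_phase_unique (mem_ray_arg (ne_zero_of_mem_ray hray)) hray
      (abs_lt.2 ⟨by linarith [hφ.2], by linarith [hφ.1]⟩)
    rwa [h3]
  have hmem : ∀ k, σ.P.1.P ((Z.onObj cl (T.factor k)).arg / Real.pi) (T.factor k) := by
    intro k
    refine (hσ.mem_iff _ (harg k) _).2 (Or.inr ⟨hss k, mem_ray_arg ?_⟩)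
    obtain ⟨φ, hφ, hray⟩ := Set.mem_iUnion₂.1
      (hσ.weakStabilityFunction _ (hss k).1 (hss k).2.1)
    exact ne_zero_of_mem_ray hray
  exact ⟨⟨n, T, fun k => (Z.onObj cl (T.factor k)).arg / Real.pi,
    fun i j hij => div_lt_div_of_pos_right (hanti hij) Real.pi_pos, hmem, fun k => (hss k).2.1⟩,
    hT, fun k => (hss k).1, harg⟩

theorem Stab.IsDeterminedBy.phase_bounds {σ : Stab L cl} {Z : CentralCharge L}
    {A : ObjectProperty D} (hσ : σ.IsDeterminedBy Z A) {E : D} (hE : A E) :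
    σ.P.1.PhaseGE 0 E ∧ σ.P.1.PhaseLE 1 E := by
  by_cases h0 : IsZero E
  · exact ⟨Slicing.phaseGE_of_isZero _ h0, Slicing.phaseLE_of_isZero _ h0⟩
  obtain ⟨h, -, -, hph⟩ := hσ.exists_hnFiltration hE h0
  exact ⟨(Slicing.phaseGE_iff_last h).2 (hph _).1.le, (Slicing.phaseLE_iff_first h).2 (hph _).2⟩

/-- If `σ_t` is determined by the heart `A` and `A` lies in `P₀([0, 1])`, then convergence of
central charges implies convergence of stability conditions. -/
theorem Stab.tendsto_of_isDeterminedBy [Module.Finite ℤ Γ] {ι : Type*} {l : Filter ι}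
    {σ : ι → Stab L cl} {σ₀ : Stab L cl} {Z : ι → CentralCharge L} {A : ObjectProperty D}
    (hZ : Filter.Tendsto Z l (𝓝 σ₀.Z)) (hσ : ∀ᶠ t in l, (σ t).IsDeterminedBy (Z t) A)
    (hA : ∀ E, A E → σ₀.P.1.PhaseGE 0 E ∧ σ₀.P.1.PhaseLE 1 E) :
    Filter.Tendsto σ l (𝓝 σ₀) := by
  refine Stab.tendsto_of_phase_bounds (hZ.congr' (hσ.mono fun t ht => ht.Z_eq.symm)) ?_
  filter_upwards [hσ] with t ht φ hφ E hE
  rcases (ht.mem_iff φ hφ E).1 hE with h0 | ⟨hss, -⟩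
  · exact ⟨Slicing.phaseGE_of_isZero _ h0, Slicing.phaseLE_of_isZero _ h0⟩
  · exact hA E hss.1

/-! ### Tilting -/

/-- The torsion part sits in degree 0 and the shifted torsion-free part in degree -1; both bounds
pass to extensions. -/
theorem tilt_le {A : TStructure D} {T F : ObjectProperty D} (hTF : IsTorsionPair A.heart T F)
    {E : D} (hE : tilt T F E) : A.IsLE E 0 ∧ A.IsGE E (-1) := by
  refine extClosure_le (Q := fun E => A.IsLE E 0 ∧ A.IsGE E (-1)) ?_ ?_ ?_ E hE
  · rintro E (⟨X, hX, ⟨e⟩⟩ | hE)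
    · obtain ⟨_, _⟩ := (A.mem_heart_iff X).1 (hTF.le_right _ hX)
      have h1 : A.IsLE (X⟦(1 : ℤ)⟧) (-1) := A.isLE_shift X 0 1 (-1)
      have h2 : A.IsGE (X⟦(1 : ℤ)⟧) (-1) := A.isGE_shift X 0 1 (-1)
      have h3 : A.IsLE (X⟦(1 : ℤ)⟧) 0 := A.isLE_of_le _ (-1) 0
      exact ⟨A.isLE_of_iso e.symm 0, A.isGE_of_iso e.symm (-1)⟩
    · obtain ⟨h1, _⟩ := (A.mem_heart_iff E).1 (hTF.le_left _ hE)
      exact ⟨h1, A.isGE_of_ge E (-1) 0⟩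
  · intro E h0
    exact ⟨A.isLE_of_isZero h0 0, A.isGE_of_isZero h0 (-1)⟩
  · rintro X hX ⟨h1, h2⟩ ⟨h3, h4⟩
    exact ⟨A.isLE₂ X hX 0 h1 h3, A.isGE₂ X hX (-1) h2 h4⟩

theorem CentralCharge.onObj_shift (Z : CentralCharge L) {E : D} (h : Z.onObj cl E ≠ 0) :
    Z.onObj cl (E⟦(1 : ℤ)⟧) = -Z.onObj cl E := by
  rw [CentralCharge.onObj, K0.of_shift, map_neg]
  exact Z.eval_neg h

theorem CentralCharge.onObj_iso (Z : CentralCharge L) {E F : D} (e : E ≅ F) :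
    Z.onObj cl F = Z.onObj cl E := by
  rw [CentralCharge.onObj, CentralCharge.onObj, K0.of_iso e]

theorem im_nonneg_of_mem_halfPlane {z : ℂ} (h : z ∈ halfPlane) : z ≠ 0 ∧ 0 ≤ z.im := by
  obtain ⟨φ, hφ, hz⟩ := Set.mem_iUnion₂.1 h
  obtain ⟨r, hr, him⟩ := im_of_mem_ray hz
  refine ⟨ne_zero_of_mem_ray hz, him ▸ mul_nonneg hr.le (Real.sin_nonneg_of_nonneg_of_le_pi ?_ ?_)⟩
  · exact mul_nonneg Real.pi_pos.le hφ.1.le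
  · nlinarith [Real.pi_pos, hφ.2]

/-- If `σ₀` is determined by a tilt of the heart `A` and its central charge is a limit of weak
stability functions on `A`, then `A` lies in `P₀([0, 1])`. -/
theorem Stab.IsDeterminedBy.phase_bounds_of_tilt {A : TStructure D} {T F : ObjectProperty D}
    (hTF : IsTorsionPair A.heart T F) {σ₀ : Stab L cl} {Z₀ : CentralCharge L}
    (hσ₀ : σ₀.IsDeterminedBy Z₀ (tilt T F)) {ι : Type*} {l : Filter ι} [l.NeBot]
    {Z : ι → CentralCharge L} (hZ : Filter.Tendsto Z l (𝓝 Z₀))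
    (hA : ∀ᶠ t in l, IsWeakStabilityFunction cl (Z t) A.heart) {E : D} (hE : A.heart E) :
    σ₀.P.1.PhaseGE 0 E ∧ σ₀.P.1.PhaseLE 1 E := by
  have hF : ∀ X, F X → σ₀.P.1.PhaseGE 0 X ∧ σ₀.P.1.PhaseLE 1 X := by
    intro X hX
    have htilt : tilt T F (X⟦(1 : ℤ)⟧) := extClosure.of _ (Or.inl ⟨X, hX, ⟨Iso.refl _⟩⟩)
    suffices h : σ₀.P.1.PhaseGE 1 (X⟦(1 : ℤ)⟧) by
      refine ⟨Slicing.phaseGE_shift_iff.1 (by simpa using h), Slicing.PhaseLE.mono (a := 0) ?_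
        zero_le_one⟩
      exact Slicing.phaseLE_shift_iff.1 (by simpa using (hσ₀.phase_bounds htilt).2)
    by_cases h0 : IsZero (X⟦(1 : ℤ)⟧)
    · exact Slicing.phaseGE_of_isZero _ h0
    obtain ⟨h, hobj, hfac, hph⟩ := hσ₀.exists_hnFiltration htilt h0
    rw [Slicing.phaseGE_iff_last h]
    obtain ⟨i, π, d, hT⟩ := h.tower.exists_last_triangle
    set G := h.tower.factor (Fin.last h.n) with hG
    set K := h.tower.obj (Fin.last h.n).castSucc with hK
    -- In the rotated triangle `X[1] ⟶ G ⟶ K[1]` both ends lie in degrees at most -1, while `G`,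
    -- being in the tilt, lies in degrees at least -1.
    have hGheart : A.heart (G⟦(-1 : ℤ)⟧) := by
      obtain ⟨_, _⟩ := (A.mem_heart_iff X).1 (hTF.le_right _ hX)
      have hX1 : A.IsLE (X⟦(1 : ℤ)⟧) (-1) := A.isLE_shift X 0 1 (-1)
      have := (tilt_le hTF (hobj (Fin.last h.n).castSucc)).1
      have hK1 : A.IsLE (K⟦(1 : ℤ)⟧) (-1) := A.isLE_shift K 0 1 (-1)
      have hG1 : A.IsLE G (-1) := A.isLE₂ _ (rot_of_distTriang _ hT) (-1) hX1 hK1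
      have hG2 : A.IsGE G (-1) := (tilt_le hTF (hfac (Fin.last h.n))).2
      exact (A.mem_heart_iff _).2 ⟨A.isLE_shift G (-1) (-1) 0, A.isGE_shift G (-1) (-1) 0⟩
    have hGzero : ¬ IsZero (G⟦(-1 : ℤ)⟧) := fun hz => h.ne_zero (Fin.last _)
      (IsZero.of_iso (Functor.map_isZero (shiftFunctor D (1 : ℤ)) hz)
        (Slicing.shiftNegShiftIso G).symm)
    have him : (Z₀.onObj cl G).im ≤ 0 := by
      have hlim : Filter.Tendsto (fun t => ((Z t).onObj cl G).im) l (𝓝 (Z₀.onObj cl G).im) :=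
        ((Complex.continuous_im.comp (CentralCharge.continuous_eval (cl (K0.of G)))).tendsto
          Z₀).comp hZ
      refine le_of_tendsto hlim (hA.mono fun t ht => ?_)
      obtain ⟨hne, him⟩ := im_nonneg_of_mem_halfPlane (ht _ hGheart hGzero)
      rw [(Z t).onObj_iso (Slicing.shiftNegShiftIso G), (Z t).onObj_shift hne, Complex.neg_im]
      linarith
    have hray := σ₀.phase _ _ (h.mem (Fin.last _)) (h.ne_zero _)
    rw [hσ₀.Z_eq] at hray
    obtain ⟨r, hr, him'⟩ := im_of_mem_ray hray
    -- A phase strictly between 0 and 1 would give a positive imaginary part.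
    by_contra! hlt
    have hsin := Real.sin_pos_of_pos_of_lt_pi
      (mul_pos Real.pi_pos (hph (Fin.last _)).1) (by nlinarith [Real.pi_pos])
    rw [him'] at him
    nlinarith
  obtain ⟨X, Y, f, g, h, hX, hY, hT⟩ := hTF.exists_triangle E hE
  have hX' := hσ₀.phase_bounds (extClosure.of X (Or.inr hX) : tilt T F X)
  exact ⟨Slicing.phaseGE_ext _ _ hT hX'.1 (hF Y hY).1, Slicing.phaseLE_ext _ _ hT hX'.2 (hF Y hY).2⟩

end Stability

end WeakStab

/-! ### Limits at the tilted endpoint and continuity on the open interval -/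

theorem lemma7p1 {D : Type u} [Category.{v} D] [HasZeroObject D] [HasShift D ℤ] [Preadditive D]
    [∀ n : ℤ, (shiftFunctor D n).Additive] [Pretriangulated D] [IsTriangulated D]
    {Γ : Type w} [AddCommGroup Γ] [Module.Free ℤ Γ] [Module.Finite ℤ Γ]
    (L : WeakStab.FilteredLattice Γ) (cl : WeakStab.K0 D →+ Γ)
    (A : TStructure D) (hA : ∀ E : D, A.bounded E) :
    (∀ T F : ObjectProperty D, WeakStab.IsTorsionPair A.heart T F →
      ∀ (Z : ℝ → WeakStab.CentralCharge L) (σ : ℝ → WeakStab.Stab L cl),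
        ContinuousOn Z (Set.Ico 0 1) →
        (∀ t ∈ Set.Ioo (0 : ℝ) 1, (σ t).IsDeterminedBy (Z t) A.heart) →
        (σ 0).IsDeterminedBy (Z 0) (WeakStab.tilt T F) →
        Filter.Tendsto σ (𝓝[>] 0) (𝓝 (σ 0))) ∧
    (∀ (Z : ℝ → WeakStab.CentralCharge L) (σ : ℝ → WeakStab.Stab L cl),
        ContinuousOn Z (Set.Ioo 0 1) →
        (∀ t ∈ Set.Ioo (0 : ℝ) 1, (σ t).IsDeterminedBy (Z t) A.heart) →
        ContinuousOn σ (Set.Ioo 0 1)) := by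
  constructor
  · intro T F hTF Z σ hZ hσ hσ₀
    have hev : ∀ᶠ t in 𝓝[>] (0 : ℝ), t ∈ Set.Ioo (0 : ℝ) 1 := Ioo_mem_nhdsGT one_pos
    have hlim : Filter.Tendsto Z (𝓝[>] 0) (𝓝 (Z 0)) := by
      rw [← nhdsWithin_Ioo_eq_nhdsGT (zero_lt_one (α := ℝ))]
      exact (hZ 0 ⟨le_rfl, one_pos⟩).mono Set.Ioo_subset_Ico_self
    refine WeakStab.Stab.tendsto_of_isDeterminedBy (hσ₀.Z_eq.symm ▸ hlim)
      (hev.mono fun t ht => hσ t ht) fun E hE => ?_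
    exact hσ₀.phase_bounds_of_tilt hTF hlim
      (hev.mono fun t ht => (hσ t ht).weakStabilityFunction) hE
  · intro Z σ hZ hσ s hs
    exact WeakStab.Stab.tendsto_of_isDeterminedBy ((hσ s hs).Z_eq.symm ▸ hZ s hs)
      (eventually_mem_nhdsWithin.mono fun t ht => hσ t ht) fun E hE => (hσ s hs).phase_bounds hE
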